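/- For $n\ge 2$, consider the complete directed graph on $n$ vertices whose $n(n-1)$ edges carry independent weights, each uniformly distributed on $[0,1]$. A \emph{shortest path} from $u$ to $v$ is a path of minimum total weight from $u$ to $v$; almost surely it is unique for every pair $(u,v)$. In a \emph{random edge update}, an edge $e$ is chosen uniformly at random, independently of the weights, and is given a new weight, uniform on $[0,1]$ and independent of everything else. Let $\mathcal{SP}_0$ and $\mathcal{SP}_1$ be the sets of shortest paths before and after the update, let $\mathcal{SP}_i(e)\subseteq\mathcal{SP}_i$ be the set of those that pass through $e$, and let $$\mathcal{SP}^-=\mathcal{SP}_0(e)\cup(\mathcal{SP}_0\setminus\mathcal{SP}_1),\qquad \mathcal{SP}^+=\mathcal{SP}_1(e)\cup(\mathcal{SP}_1\setminus\mathcal{SP}_0)$$ be the sets of shortest paths destroyed and created (or recreated) by the update. Then, as $n\to\infty$, $$\mathbb{E}\bigl[|\mathcal{SP}^-|\bigr]=\mathbb{E}\bigl[|\mathcal{SP}^+|\bigr]\le(2+o(1))\ln n,$$ where the equality holds for every $n\ge 2$. Moreover, for every $n\ge2$, the expected number of shortest paths that pass through a uniformly random edge (chosen independently of the weights) equals the expected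 number of edges on the shortest path from $u$ to $v$, where $(u,v)$ is a uniformly random ordered pair of distinct vertices (also chosen independently of the weights), and this expected number is $(1+o(1))\ln n$. -/

import Mathlib

open MeasureTheory Filter Topology

noncomputable section

namespace RandomAPSP

/-- The edges of the complete directed graph on `n` vertices: the `n * (n - 1)` ordered pairs of
distinct vertices. The edge `e` goes from `e.fst` to `e.snd`. -/
abbrev Edge (n : ℕ) : Type := (⊤ : SimpleGraph (Fin n)).Dart

instance instMeasurableSpaceEdge (n : ℕ) : MeasurableSpace (Edge n) := ⊤

instance instDiscreteMeasurableSpaceEdge (n : ℕ) : DiscreteMeasurableSpace (Edge n) :=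
  ⟨fun _ => trivial⟩

/-- The paths (no repeated vertices) from `u` to `v` in the complete directed graph. They are
traversed from `u` to `v`, so the directed edges used are the darts of the walk. -/
abbrev PathBetween (n : ℕ) (u v : Fin n) : Type := (⊤ : SimpleGraph (Fin n)).Path u v

/-- All the paths in the complete directed graph, with arbitrary endpoints. -/
abbrev DiPath (n : ℕ) : Type := Σ u v : Fin n, PathBetween n u v

/-- The list of directed edges of a path. -/
def edgesOf {n : ℕ} {u v : Fin n} (p : PathBetween n u v) : List (Edge n) :=
  p.1.darts

/-- The weight of a path: the sum of the weights of its edges. -/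
def pathWeight {n : ℕ} (w : Edge n → ℝ) {u v : Fin n} (p : PathBetween n u v) : ℝ :=
  ((edgesOf p).map w).sum

/-- `p` has minimum weight among all the paths with the same endpoints. -/
def IsShortest {n : ℕ} (w : Edge n → ℝ) {u v : Fin n} (p : PathBetween n u v) : Prop :=
  ∀ q : PathBetween n u v, pathWeight w p ≤ pathWeight w q

/-- The set of all shortest paths with respect to the weights `w`. -/
def SP {n : ℕ} (w : Edge n → ℝ) : Set (DiPath n) :=
  {π | IsShortest w π.2.2}

/-- The set of all shortest paths, with respect to the weights `w`, that pass through `e`. -/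
def SPThrough {n : ℕ} (w : Edge n → ℝ) (e : Edge n) : Set (DiPath n) :=
  {π | IsShortest w π.2.2 ∧ e ∈ edgesOf π.2.2}

/-- The shortest paths destroyed when the weights change from `w₀` to `w₁` by an update of the
edge `e`: those that pass through `e` before the update, and those that stop being shortest. -/
def SPDestroyed {n : ℕ} (w₀ w₁ : Edge n → ℝ) (e : Edge n) : Set (DiPath n) :=
  SPThrough w₀ e ∪ (SP w₀ \ SP w₁)

/-- The shortest paths created (or recreated) when the weights change from `w₀` to `w₁` by an
update of the edge `e`: those that pass through `e` after the update, and those that become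
shortest. -/
def SPCreated {n : ℕ} (w₀ w₁ : Edge n → ℝ) (e : Edge n) : Set (DiPath n) :=
  SPThrough w₁ e ∪ (SP w₁ \ SP w₀)

/-- The number of edges on the shortest path from `u` to `v`. (The shortest path is almost surely
unique; if it is not, the least number of edges of a shortest path is taken.) -/
def hopCount {n : ℕ} (w : Edge n → ℝ) (u v : Fin n) : ℕ :=
  sInf {k | ∃ p : PathBetween n u v, IsShortest w p ∧ (edgesOf p).length = k}

/-- The uniform distribution on `[0, 1]`. -/
def unifLaw : Measure ℝ := volume.restrict (Set.Icc 0 1)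

/-- The joint law of independent edge weights, each uniform on `[0, 1]`. -/
def weightLaw (n : ℕ) : Measure (Edge n → ℝ) := Measure.pi fun _ => unifLaw

/-- The law of a uniformly random edge. -/
def edgeLaw (n : ℕ) : Measure (Edge n) := ProbabilityTheory.uniformOn Set.univ

/-- A random weighted graph together with an independent, uniformly random edge. -/
def graphEdgeLaw (n : ℕ) : Measure ((Edge n → ℝ) × Edge n) := (weightLaw n).prod (edgeLaw n)

/-- The sample space of a random edge update: the old weights, the updated edge, and its new
weight. -/
abbrev UpdateSpace (n : ℕ) : Type := (Edge n → ℝ) × Edge n × ℝ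

/-- The law of a random edge update: independent old weights uniform on `[0, 1]`, an independent
uniformly random edge, and an independent new weight uniform on `[0, 1]`. -/
def updateLaw (n : ℕ) : Measure (UpdateSpace n) :=
  (weightLaw n).prod ((edgeLaw n).prod unifLaw)

/-- The weights before the update. -/
def oldWeights {n : ℕ} (ω : UpdateSpace n) : Edge n → ℝ := ω.1

/-- The updated edge. -/
def updatedEdge {n : ℕ} (ω : UpdateSpace n) : Edge n := ω.2.1

/-- The weights after the update: the updated edge gets its new weight, all others keep theirs. -/
def newWeights {n : ℕ} (ω : UpdateSpace n) : Edge n → ℝ :=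
  Function.update ω.1 ω.2.1 ω.2.2

/-- The number of shortest paths destroyed by the update. -/
def numDestroyed {n : ℕ} (ω : UpdateSpace n) : ℝ :=
  (SPDestroyed (oldWeights ω) (newWeights ω) (updatedEdge ω)).ncard

/-- The number of shortest paths created (or recreated) by the update. -/
def numCreated {n : ℕ} (ω : UpdateSpace n) : ℝ :=
  (SPCreated (oldWeights ω) (newWeights ω) (updatedEdge ω)).ncard

/-- The number of shortest paths passing through the random edge. -/
def numThrough {n : ℕ} (x : (Edge n → ℝ) × Edge n) : ℝ :=
  (SPThrough x.1 x.2).ncard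

/-- The number of edges on the shortest path between the two endpoints of the random edge, i.e.
between the two entries of a uniformly random ordered pair of distinct vertices. -/
def hopCountRandomPair {n : ℕ} (x : (Edge n → ℝ) × Edge n) : ℝ :=
  hopCount x.1 x.2.fst x.2.snd

end RandomAPSP

end

/-!
Write `H` for the number of edges and `d` for the weight of the shortest path between a uniformly
random ordered pair of distinct vertices.

*Updates.* The weights before and after an update are exchangeable
(`measurePreserving_reverseUpdate`), and exchanging them turns destroyed paths into created ones.
If a shortest path that avoids the updated edge is destroyed, then the path replacing it passes
through that edge. Almost surely shortest paths are unique (`ae_isShortest_unique`), so the number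
of destroyed paths is at most the number of shortest paths through the updated edge before the
update plus the number of those after it, which have the same expectation
(`integral_numDestroyed_le`). Counting pairs of a shortest path and one of its edges in two ways
identifies this expectation with that of `H` (`sum_ncard_SPThrough`).

*The number of edges.* There are at most `n ^ (k + 1)` nontrivial paths with `k` edges, and the
expectation of `exp (-θ * W)` for the weight `W` of such a path is at most `θ⁻¹ ^ k`. Hence, for
`0 < μ < lam`, the sum of `μ ^ k * exp (-lam * n * W)` over all nontrivial paths has expectation at
most `n / (1 - μ / lam)`. The shortest paths contribute `μ ^ H * exp (-lam * n * d)`, so Jensen's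
inequality gives `E[H] * log μ ≤ lam * n * E[d] - log n + O(1)`
(`integral_hopCountRandomPair_mul_log_le`). Since `n * E[d] ≤ (1 + o(1)) * log n`, letting `lam` and
then `μ` tend to `1`, from above and from below, yields `E[H] = (1 + o(1)) * log n`
(`tendsto_div_log_of_forall_mul_log_le`).

*The distance.* For fixed `u`, the sum of the distances `dist w u v` over `v` is the integral over
the time `t ≥ 0` of the number of vertices outside the ball of radius `t` around `u`. For a set `S`
with `k` elements, the ball equals `S` exactly from the time when the exploration inside `S` is
complete until an edge leaving `S` has been traversed. Given the other weights, each of the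
`k * (n - k)` leaving edges has to exceed a threshold that increases with time, so this takes
expected time at most `1 / (k * (n - k))` times the probability that `S` is a ball at all
(`pi_unifLaw_add_lt_le`, `lintegral_volume_waitingTimes_le`). As balls are nested, these
probabilities sum to at most `1` over the sets with `k` elements, and the expected sum of the
distances is at most the `n`-th harmonic number (`lintegral_sum_dist_le`).
-/

namespace RandomAPSP

variable {n : ℕ}

/-! ### Paths in the complete directed graph -/

instance instFinitePathBetween (n : ℕ) (u v : Fin n) : Finite (PathBetween n u v) :=
  Finite.of_injective (β := {l : List (Fin n) // l.Nodup})
    (fun p => ⟨p.1.support, p.2.support_nodup⟩)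
    fun _ _ h => Subtype.ext (SimpleGraph.Walk.ext_support (Subtype.mk.inj h))

theorem eq_of_darts_subset {V : Type*} {G : SimpleGraph V} {u v : V} {p q : G.Walk u v}
    (hp : p.IsPath) (hq : q.IsPath) (h : p.darts ⊆ q.darts) : p = q := by
  induction p with
  | nil => exact (SimpleGraph.Walk.isPath_iff_nil.1 hq).eq_nil.symm
  | @cons u x v hux p ih =>
    rw [SimpleGraph.Walk.cons_isPath_iff] at hp
    cases q with
    | nil => simp at h
    | @cons _ x' _ hux' q =>
      rw [SimpleGraph.Walk.cons_isPath_iff] at hq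
      have h1 : (⟨(u, x), hux⟩ : G.Dart) ∈ (SimpleGraph.Walk.cons hux' q).darts := h (by simp)
      rw [SimpleGraph.Walk.darts_cons, List.mem_cons] at h1
      obtain h1 | h1 := h1
      · obtain rfl : x = x' := by simpa using congrArg (fun d : G.Dart => d.snd) h1
        congr 1
        refine ih hp.1 hq.1 fun d hd => ?_
        have h2 : d ∈ (SimpleGraph.Walk.cons hux' q).darts := h (by simp [hd])
        rw [SimpleGraph.Walk.darts_cons, List.mem_cons] at h2
        obtain rfl | h2 := h2
        · exact absurd (p.dart_fst_mem_support_of_mem_darts hd) hp.2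
        · exact h2
      · exact absurd (q.dart_fst_mem_support_of_mem_darts h1) hq.2

/-- A walk leaving a set splits at the first edge that leaves it. -/
theorem exists_eq_append_cons_of_leaves {V : Type*} {G : SimpleGraph V} {S : Set V} {a b : V}
    (p : G.Walk a b) (ha : a ∈ S) (hb : b ∉ S) :
    ∃ (x y : V) (h : G.Adj x y) (p₁ : G.Walk a x) (p₂ : G.Walk y b),
      p = p₁.append (.cons h p₂) ∧ (∀ z ∈ p₁.support, z ∈ S) ∧ y ∉ S := by
  induction p with
  | nil => exact absurd ha hb
  | @cons a c b h p ih =>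
    by_cases hc : c ∈ S
    · obtain ⟨x, y, hxy, p₁, p₂, rfl, h₁, h₂⟩ := ih hc hb
      refine ⟨x, y, hxy, .cons h p₁, p₂, rfl, ?_, h₂⟩
      simp only [SimpleGraph.Walk.support_cons, List.mem_cons]
      rintro z (rfl | hz)
      exacts [ha, h₁ z hz]
    · exact ⟨a, c, h, .nil, p, rfl, by simpa using ha, hc⟩

theorem edgesOf_nodup {u v : Fin n} (p : PathBetween n u v) : (edgesOf p).Nodup :=
  SimpleGraph.Walk.darts_nodup_of_support_nodup p.2.support_nodup

theorem exists_mem_edgesOf_of_ne {u v : Fin n} {p q : PathBetween n u v} (h : p ≠ q) :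
    ∃ e ∈ edgesOf p, e ∉ edgesOf q := by
  by_contra! H
  exact h (Subtype.ext (eq_of_darts_subset p.2 q.2 H))

theorem pathWeight_eq_sum {u v : Fin n} (w : Edge n → ℝ) (p : PathBetween n u v) :
    pathWeight w p = ∑ e, if e ∈ edgesOf p then w e else 0 := by
  rw [pathWeight, ← List.sum_toFinset w (edgesOf_nodup p), ← Finset.sum_filter]
  congr 1
  ext e
  simp

theorem pathWeight_nonneg {u v : Fin n} {w : Edge n → ℝ} (hw : ∀ e, 0 ≤ w e)
    (p : PathBetween n u v) : 0 ≤ pathWeight w p :=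
  List.sum_nonneg (by simpa using fun e _ => hw e)

/-- The edge from `u` to `v`, or the trivial path if `u = v`. -/
theorem exists_path_within (S : Finset (Fin n)) {u v : Fin n} (hu : u ∈ S) (hv : v ∈ S) :
    ∃ p : PathBetween n u v, ∀ y ∈ p.1.support, y ∈ S := by
  by_cases h : u = v
  · subst h
    exact ⟨.nil, by simpa using hu⟩
  · refine ⟨.singleton (show (⊤ : SimpleGraph (Fin n)).Adj u v from h), ?_⟩
    simp [SimpleGraph.Path.singleton, hu, hv]

/-- The distance from `u` to `v` inside `S`: the least weight of a path from `u` to `v` all of whose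
vertices lie in `S`. -/
noncomputable def distIn (S : Finset (Fin n)) (w : Edge n → ℝ) (u v : Fin n) : ℝ :=
  ⨅ p : {p : PathBetween n u v // ∀ y ∈ p.1.support, y ∈ S}, pathWeight w p.1

/-- The weight of the shortest paths from `u` to `v`. -/
noncomputable abbrev dist (w : Edge n → ℝ) (u v : Fin n) : ℝ := distIn Finset.univ w u v

theorem distIn_le {S : Finset (Fin n)} (w : Edge n → ℝ) {u v : Fin n} (p : PathBetween n u v)
    (hp : ∀ y ∈ p.1.support, y ∈ S) : distIn S w u v ≤ pathWeight w p :=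
  ciInf_le (Set.finite_range _).bddBelow
    (⟨p, hp⟩ : {p : PathBetween n u v // ∀ y ∈ p.1.support, y ∈ S})

theorem exists_pathWeight_eq_distIn {S : Finset (Fin n)} (w : Edge n → ℝ) {u v : Fin n}
    (hu : u ∈ S) (hv : v ∈ S) :
    ∃ p : PathBetween n u v, (∀ y ∈ p.1.support, y ∈ S) ∧ pathWeight w p = distIn S w u v := by
  obtain ⟨p₀, hp₀⟩ := exists_path_within S hu hv
  have : Nonempty {p : PathBetween n u v // ∀ y ∈ p.1.support, y ∈ S} := ⟨⟨p₀, hp₀⟩⟩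
  obtain ⟨p, hp⟩ := exists_eq_ciInf_of_finite
    (f := fun p : {p : PathBetween n u v // ∀ y ∈ p.1.support, y ∈ S} => pathWeight w p.1)
  exact ⟨p.1, p.2, hp⟩

theorem dist_le (w : Edge n → ℝ) {u v : Fin n} (p : PathBetween n u v) :
    dist w u v ≤ pathWeight w p := distIn_le w p (by simp)

theorem exists_isShortest (w : Edge n → ℝ) (u v : Fin n) :
    ∃ p : PathBetween n u v, IsShortest w p := by
  obtain ⟨p, -, hp⟩ := exists_pathWeight_eq_distIn w (Finset.mem_univ u) (Finset.mem_univ v)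
  exact ⟨p, fun q => hp ▸ dist_le w q⟩

theorem IsShortest.pathWeight_eq {w : Edge n → ℝ} {u v : Fin n} {p : PathBetween n u v}
    (hp : IsShortest w p) : pathWeight w p = dist w u v := by
  obtain ⟨q, -, hq⟩ := exists_pathWeight_eq_distIn w (Finset.mem_univ u) (Finset.mem_univ v)
  exact le_antisymm ((hp q).trans_eq hq) (dist_le w p)

theorem exists_isShortest_length_eq_hopCount (w : Edge n → ℝ) (u v : Fin n) :
    ∃ p : PathBetween n u v, IsShortest w p ∧ (edgesOf p).length = hopCount w u v := by
  obtain ⟨p, hp⟩ := exists_isShortest w u v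
  exact Nat.sInf_mem (s := {k | ∃ p : PathBetween n u v, IsShortest w p ∧ (edgesOf p).length = k})
    ⟨_, p, hp, rfl⟩

theorem dist_nonneg {w : Edge n → ℝ} (hw : ∀ e, 0 ≤ w e) (u v : Fin n) : 0 ≤ dist w u v := by
  obtain ⟨p, hp⟩ := exists_isShortest w u v
  exact hp.pathWeight_eq ▸ pathWeight_nonneg hw p

theorem dist_self_nonpos (w : Edge n → ℝ) (u : Fin n) : dist w u u ≤ 0 :=
  (dist_le w .nil).trans_eq rfl

/-- The distance inside `S` only depends on the weights of the edges that do not leave `S`. -/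
theorem distIn_congr {S : Finset (Fin n)} {w w' : Edge n → ℝ}
    (h : ∀ e : Edge n, ¬ (e.fst ∈ S ∧ e.snd ∉ S) → w e = w' e) (u v : Fin n) :
    distIn S w u v = distIn S w' u v := by
  refine iInf_congr fun p => ?_
  unfold pathWeight edgesOf
  congr 1
  refine List.map_congr_left fun e he => h e fun h' => h'.2 ?_
  exact p.2 _ (p.1.1.dart_snd_mem_support_of_mem_darts he)

theorem dist_le_distIn_add {S : Finset (Fin n)} (w : Edge n → ℝ) {u : Fin n} (hu : u ∈ S)
    (e : Edge n) (h₁ : e.fst ∈ S) (h₂ : e.snd ∉ S) :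
    dist w u e.snd ≤ distIn S w u e.fst + w e := by
  obtain ⟨p, hp, hpw⟩ := exists_pathWeight_eq_distIn w hu h₁
  have hq : (p.1.concat e.adj).IsPath := p.2.concat (fun h => h₂ (hp _ h)) e.adj
  refine (dist_le w ⟨_, hq⟩).trans_eq ?_
  simp [pathWeight, edgesOf, SimpleGraph.Walk.darts_concat, ← hpw]

/-- A path leaving `S` is at least as long as the way to its first edge that leaves `S`. -/
theorem exists_distIn_add_le {S : Finset (Fin n)} {w : Edge n → ℝ} (hw : ∀ e, 0 ≤ w e)
    {u v : Fin n} (hu : u ∈ S) (hv : v ∉ S) :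
    ∃ e : Edge n, e.fst ∈ S ∧ e.snd ∉ S ∧ distIn S w u e.fst + w e ≤ dist w u v := by
  obtain ⟨p, hp⟩ := exists_isShortest w u v
  obtain ⟨x, y, h, p₁, p₂, hpe, h₁, h₂⟩ :=
    exists_eq_append_cons_of_leaves (S := (S : Set (Fin n))) p.1 (by simpa using hu)
      (by simpa using hv)
  have hpath : (p₁.append (.cons h p₂)).IsPath := hpe ▸ p.2
  refine ⟨⟨(x, y), h⟩, by simpa using h₁ x p₁.end_mem_support, by simpa using h₂, ?_⟩
  have hle := distIn_le (S := S) w ⟨p₁, hpath.of_append_left⟩ (by simpa using h₁)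
  have hnn : 0 ≤ (p₂.darts.map w).sum := List.sum_nonneg (by simpa using fun e _ => hw e)
  rw [← hp.pathWeight_eq]
  simp only [pathWeight, edgesOf, hpe, SimpleGraph.Walk.darts_append, List.map_append,
    List.sum_append, SimpleGraph.Walk.darts_cons, List.map_cons, List.sum_cons] at hle ⊢
  linarith

/-- The vertices at distance at most `t` from `u`. -/
noncomputable def ball (w : Edge n → ℝ) (u : Fin n) (t : ℝ) : Finset (Fin n) :=
  {v | dist w u v ≤ t}

theorem mem_ball {w : Edge n → ℝ} {u v : Fin n} {t : ℝ} : v ∈ ball w u t ↔ dist w u v ≤ t := by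
  simp [ball]

theorem ball_mono (w : Edge n → ℝ) (u : Fin n) : Monotone (ball w u) :=
  fun _ _ hst _ hv => mem_ball.2 ((mem_ball.1 hv).trans hst)

theorem self_mem_ball (w : Edge n → ℝ) (u : Fin n) {t : ℝ} (ht : 0 ≤ t) : u ∈ ball w u t :=
  mem_ball.2 ((dist_self_nonpos w u).trans ht)

/-- Shortest paths to vertices of a ball stay inside the ball. -/
theorem distIn_ball_le {w : Edge n → ℝ} (hw : ∀ e, 0 ≤ w e) {u v : Fin n} {t : ℝ}
    (hv : v ∈ ball w u t) : distIn (ball w u t) w u v ≤ t := by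
  obtain ⟨p, hp⟩ := exists_isShortest w u v
  have hpt : pathWeight w p ≤ t := hp.pathWeight_eq.trans_le (mem_ball.1 hv)
  refine (distIn_le w p fun y hy => mem_ball.2 ?_).trans hpt
  refine (dist_le w ⟨_, p.2.takeUntil hy⟩).trans (le_trans ?_ hpt)
  have hnn : 0 ≤ ((p.1.dropUntil y hy).darts.map w).sum :=
    List.sum_nonneg (by simpa using fun e _ => hw e)
  have hsplit := congrArg (fun q => (q.darts.map w).sum) (p.1.take_spec hy)
  simp only [SimpleGraph.Walk.darts_append, List.map_append, List.sum_append] at hsplit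
  simp only [pathWeight, edgesOf]
  linarith

/-- The largest distance inside `S` from `u` to a vertex of `S`. -/
noncomputable def radius (S : Finset (Fin n)) (w : Edge n → ℝ) (u : Fin n) : ℝ :=
  ⨆ x : S, distIn S w u x

theorem distIn_le_radius {S : Finset (Fin n)} (w : Edge n → ℝ) (u : Fin n) {x : Fin n}
    (hx : x ∈ S) : distIn S w u x ≤ radius S w u :=
  le_ciSup (f := fun x : S => distIn S w u x) (Set.finite_range _).bddAbove ⟨x, hx⟩

/-- The slack of an edge `e` leaving `S`: the weight that `e` exceeds if its head is still
unreached at the time when the exploration from `u` inside `S` has reached all of `S`. -/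
noncomputable def slack (S : Finset (Fin n)) (u : Fin n) (w : Edge n → ℝ) (e : Edge n) : ℝ :=
  radius S w u - distIn S w u e.fst

theorem slack_nonneg {S : Finset (Fin n)} (u : Fin n) (w : Edge n → ℝ) {e : Edge n}
    (he : e.fst ∈ S) : 0 ≤ slack S u w e :=
  sub_nonneg.2 (distIn_le_radius w u he)

theorem slack_congr {S : Finset (Fin n)} {w w' : Edge n → ℝ}
    (h : ∀ e : Edge n, ¬ (e.fst ∈ S ∧ e.snd ∉ S) → w e = w' e) (u : Fin n) :
    slack S u w = slack S u w' := by
  ext e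
  simp only [slack, radius, distIn_congr h]

theorem radius_le_and_slack_lt_of_ball_eq {S : Finset (Fin n)} {w : Edge n → ℝ}
    (hw : ∀ e, 0 ≤ w e) {u : Fin n} {t : ℝ} (hu : u ∈ S) (hS : ball w u t = S) :
    radius S w u ≤ t ∧
      ∀ e : Edge n, e.fst ∈ S ∧ e.snd ∉ S → slack S u w e + (t - radius S w u) < w e := by
  have : Nonempty S := ⟨⟨u, hu⟩⟩
  constructor
  · refine ciSup_le fun x => ?_
    have := distIn_ball_le hw (u := u) (t := t) (v := x) (by rw [hS]; exact x.2)
    rwa [hS] at this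
  · rintro e ⟨h₁, h₂⟩
    have h3 : t < dist w u e.snd := by
      rw [← not_le, ← mem_ball, hS]
      exact h₂
    have := dist_le_distIn_add w hu e h₁ h₂
    rw [slack]
    linarith

theorem ball_radius_eq {S : Finset (Fin n)} {w : Edge n → ℝ} (hw : ∀ e, 0 ≤ w e) {u : Fin n}
    (hu : u ∈ S) (h : ∀ e : Edge n, e.fst ∈ S ∧ e.snd ∉ S → slack S u w e < w e) :
    ball w u (radius S w u) = S := by
  ext v
  rw [mem_ball]
  constructor
  · contrapose!
    intro hv
    obtain ⟨e, h₁, h₂, hle⟩ := exists_distIn_add_le hw hu hv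
    have := h e ⟨h₁, h₂⟩
    rw [slack] at this
    linarith
  · intro hv
    obtain ⟨p, -, hp⟩ := exists_pathWeight_eq_distIn w hu hv
    exact ((dist_le w p).trans_eq hp).trans (distIn_le_radius w u hv)

/-- Balls around `u` are nested, so at most one of them has a given number of vertices. -/
theorem eq_of_slack_lt {S T : Finset (Fin n)} {w : Edge n → ℝ} (hw : ∀ e, 0 ≤ w e) {u : Fin n}
    (hS : u ∈ S) (hT : u ∈ T) (hcard : S.card = T.card)
    (h : ∀ e : Edge n, e.fst ∈ S ∧ e.snd ∉ S → slack S u w e < w e)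
    (h' : ∀ e : Edge n, e.fst ∈ T ∧ e.snd ∉ T → slack T u w e < w e) : S = T := by
  rw [← ball_radius_eq hw hS h, ← ball_radius_eq hw hT h'] at hcard ⊢
  obtain hle | hle := le_total (radius S w u) (radius T w u)
  · exact Finset.eq_of_subset_of_card_le (ball_mono w u hle) hcard.ge
  · exact (Finset.eq_of_subset_of_card_le (ball_mono w u hle) hcard.le).symm

/-! ### The law of the weights -/

instance instIsProbabilityMeasureUnifLaw : IsProbabilityMeasure unifLaw :=
  ⟨by simp [unifLaw]⟩

instance instIsProbabilityMeasureWeightLaw (n : ℕ) : IsProbabilityMeasure (weightLaw n) := by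
  unfold weightLaw
  infer_instance

theorem ae_weightLaw_nonneg : ∀ᵐ w ∂(weightLaw n), ∀ e, 0 ≤ w e := by
  refine ae_all_iff.2 fun e => ?_
  refine (measurePreserving_eval (fun _ : Edge n => unifLaw) e).quasiMeasurePreserving.ae ?_
  exact (ae_restrict_mem measurableSet_Icc).mono fun x hx => hx.1

theorem weightLaw_absolutelyContinuous : weightLaw n ≪ volume := by
  unfold weightLaw unifLaw
  rw [← Measure.restrict_pi_pi]
  exact Measure.restrict_le_self.absolutelyContinuous

theorem measurable_pathWeight {u v : Fin n} (p : PathBetween n u v) :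
    Measurable fun w : Edge n → ℝ => pathWeight w p := by
  simp_rw [pathWeight_eq_sum]
  refine Finset.measurable_sum _ fun e _ => ?_
  split_ifs <;> fun_prop

theorem measurable_distIn (S : Finset (Fin n)) (u v : Fin n) :
    Measurable fun w : Edge n → ℝ => distIn S w u v :=
  .iInf fun p => measurable_pathWeight p.1

theorem measurable_slack (S : Finset (Fin n)) (u : Fin n) (e : Edge n) :
    Measurable fun w : Edge n → ℝ => slack S u w e := by
  unfold slack radius
  have h : Measurable fun w : Edge n → ℝ => ⨆ x : S, distIn S w u x :=
    .iSup fun x => measurable_distIn S u x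
  exact h.sub (measurable_distIn S u e.fst)

/-- Two different paths with the same endpoints almost surely have different weights: the weights
for which they agree form a proper subspace. -/
theorem ae_pathWeight_ne {u v : Fin n} {p q : PathBetween n u v} (h : p ≠ q) :
    ∀ᵐ w ∂(weightLaw n), pathWeight w p ≠ pathWeight w q := by
  refine weightLaw_absolutelyContinuous.ae_le ?_
  let L : (Edge n → ℝ) →ₗ[ℝ] ℝ := ∑ e, ((if e ∈ edgesOf p then 1 else 0) -
    (if e ∈ edgesOf q then 1 else 0) : ℝ) • LinearMap.proj e
  have hL : ∀ w, L w = pathWeight w p - pathWeight w q := fun w => by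
    simp only [L, pathWeight_eq_sum, ← Finset.sum_sub_distrib, LinearMap.sum_apply,
      LinearMap.smul_apply, LinearMap.proj_apply, smul_eq_mul]
    refine Finset.sum_congr rfl fun e _ => ?_
    split_ifs <;> ring
  have hker : LinearMap.ker L ≠ ⊤ := by
    intro htop
    obtain ⟨e, he, he'⟩ := exists_mem_edgesOf_of_ne h
    have h0 : L (Pi.single e 1) = 0 := by
      rw [← LinearMap.mem_ker, htop]
      exact Submodule.mem_top
    simp [L, LinearMap.sum_apply, Pi.single_apply, he, he'] at h0
  refine measure_mono_null (fun w hw => ?_) (Measure.addHaar_submodule volume _ hker)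
  have hw' : pathWeight w p = pathWeight w q := not_not.1 hw
  exact LinearMap.mem_ker.2 (by rw [hL, hw', sub_self])

/-- Almost surely, all shortest paths are unique. -/
theorem ae_isShortest_unique :
    ∀ᵐ w ∂(weightLaw n), ∀ (u v : Fin n) (p q : PathBetween n u v),
      IsShortest w p → IsShortest w q → p = q := by
  simp_rw [ae_all_iff]
  intro u v p q
  by_cases h : p = q
  · exact .of_forall fun _ _ _ => h
  · filter_upwards [ae_pathWeight_ne h] with w hw hp hq
    exact absurd (le_antisymm (hp q) (hq p)) hw

/-! ### The expected distance -/

theorem unifLaw_Ioi_add_le {a s : ℝ} (ha : 0 ≤ a) (hs : 0 ≤ s) :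
    unifLaw (Set.Ioi (a + s)) ≤ ENNReal.ofReal (Real.exp (-s)) * unifLaw (Set.Ioi a) := by
  have key : ∀ {b : ℝ}, 0 ≤ b → unifLaw (Set.Ioi b) = ENNReal.ofReal (1 - b) := fun {b} hb => by
    have hset : Set.Ioi b ∩ Set.Icc 0 1 = Set.Ioc b 1 := by
      ext x
      simp only [Set.mem_inter_iff, Set.mem_Ioi, Set.mem_Icc, Set.mem_Ioc]
      exact ⟨fun h => ⟨h.1, h.2.2⟩, fun h => ⟨h.1, hb.trans h.1.le, h.2⟩⟩
    rw [unifLaw, Measure.restrict_apply measurableSet_Ioi, hset, Real.volume_Ioc]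
  rw [key ha, key (add_nonneg ha hs), ← ENNReal.ofReal_mul (Real.exp_pos _).le]
  obtain h | h := le_total a 1
  · refine ENNReal.ofReal_le_ofReal ?_
    have h1 : (1 - s) * (1 - a) ≤ Real.exp (-s) * (1 - a) :=
      mul_le_mul_of_nonneg_right (by linarith [Real.add_one_le_exp (-s)]) (by linarith)
    nlinarith [mul_nonneg ha hs]
  · rw [ENNReal.ofReal_of_nonpos (by linarith)]
    exact zero_le

/-- The uniform distribution is new better than used: if weights exceed thresholds that are
determined by the remaining weights, then raising the thresholds by `s` costs at least a
factor `exp (-s)` for each of them. -/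
theorem pi_unifLaw_add_lt_le {ι : Type*} [Fintype ι] (P : ι → Prop) [DecidablePred P]
    {a : (ι → ℝ) → ι → ℝ} (ha : ∀ i, Measurable fun w => a w i)
    (hcongr : ∀ w w', (∀ i, ¬ P i → w i = w' i) → a w = a w')
    (hnonneg : ∀ w i, P i → 0 ≤ a w i) {s : ℝ} (hs : 0 ≤ s) :
    Measure.pi (fun _ : ι => unifLaw) {w | ∀ i, P i → a w i + s < w i} ≤
      ENNReal.ofReal (Real.exp (-(Fintype.card {i // P i} * s))) *
        Measure.pi (fun _ : ι => unifLaw) {w | ∀ i, P i → a w i < w i} := by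
  let φ := MeasurableEquiv.piEquivPiSubtypeProd (fun _ : ι => ℝ) P
  have hφ := measurePreserving_piEquivPiSubtypeProd (fun _ : ι => unifLaw) P
  have hmeas : ∀ r : ℝ, MeasurableSet {w : ι → ℝ | ∀ i, P i → a w i + r < w i} := fun r => by
    simp_rw [Set.ofPred_forall]
    refine .iInter fun i => .iInter fun _ => ?_
    exact measurableSet_lt ((ha i).add_const r) (measurable_pi_apply i)
  let b : ({i // ¬ P i} → ℝ) → ι → ℝ := fun z => a (φ.symm (0, z))
  have key : ∀ r : ℝ, Measure.pi (fun _ : ι => unifLaw) {w | ∀ i, P i → a w i + r < w i} =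
      ∫⁻ z, ∏ i : {i // P i}, unifLaw (Set.Ioi (b z i + r))
        ∂(Measure.pi fun _ : {i // ¬ P i} => unifLaw) := by
    intro r
    rw [← (hφ.symm φ).measure_preimage (hmeas r).nullMeasurableSet,
      Measure.prod_apply_symm (φ.symm.measurable (hmeas r))]
    refine lintegral_congr fun z => ?_
    rw [← Measure.pi_pi]
    congr 1
    ext y
    have hab : a (φ.symm (y, z)) = b z := by
      refine hcongr _ _ fun i hi => ?_
      simp [φ, MeasurableEquiv.piEquivPiSubtypeProd, hi]
    simp only [Set.mem_preimage, Set.mem_ofPred_eq, hab, Set.mem_pi, Set.mem_univ, true_imp_iff,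
      Set.mem_Ioi, Subtype.forall]
    refine forall_congr' fun i => forall_congr' fun hi => ?_
    simp [φ, MeasurableEquiv.piEquivPiSubtypeProd, hi]
  have key0 := key 0
  simp only [add_zero] at key0
  rw [key s, key0, ← lintegral_const_mul' _ _ ENNReal.ofReal_ne_top]
  refine lintegral_mono fun z => ?_
  calc ∏ i : {i // P i}, unifLaw (Set.Ioi (b z i + s))
      ≤ ∏ i : {i // P i}, ENNReal.ofReal (Real.exp (-s)) * unifLaw (Set.Ioi (b z i)) :=
        Finset.prod_le_prod' fun i _ => unifLaw_Ioi_add_le (hnonneg _ _ i.2) hs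
    _ = _ := by
        rw [Finset.prod_mul_distrib, Finset.prod_const, ← ENNReal.ofReal_pow (Real.exp_pos _).le,
          ← Real.exp_nat_mul, Finset.card_univ, mul_neg]

/-- At least this many edges leave `S`. -/
theorem card_mul_card_compl_le (S : Finset (Fin n)) :
    S.card * Sᶜ.card ≤ Fintype.card {e : Edge n // e.fst ∈ S ∧ e.snd ∉ S} := by
  rw [← Finset.card_product, ← Fintype.card_coe]
  refine Fintype.card_le_of_injective (fun x : {x // x ∈ S ×ˢ Sᶜ} =>
    (⟨⟨x.1, fun h => ?_⟩, by simpa using Finset.mem_product.1 x.2⟩ :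
      {e : Edge n // e.fst ∈ S ∧ e.snd ∉ S})) ?_
  · have hx := Finset.mem_product.1 x.2
    rw [h] at hx
    exact (Finset.mem_compl.1 hx.2) hx.1
  · intro x y hxy
    exact Subtype.ext (congrArg (fun e => e.1.toProd) hxy)

/-- The weights for which `S` is one of the balls around `u`, the radius of `S` being one of its
radii. -/
def ballEvent (S : Finset (Fin n)) (u : Fin n) : Set (Edge n → ℝ) :=
  {w | ∀ e : Edge n, e.fst ∈ S ∧ e.snd ∉ S → slack S u w e < w e}

/-- The times, after all of `S` has been reached, until the exploration of `S` from `u` leaves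
`S`. -/
def waitingTimes (S : Finset (Fin n)) (u : Fin n) (w : Edge n → ℝ) : Set ℝ :=
  {s | 0 ≤ s ∧ ∀ e : Edge n, e.fst ∈ S ∧ e.snd ∉ S → slack S u w e + s < w e}

theorem measurableSet_ballEvent (S : Finset (Fin n)) (u : Fin n) :
    MeasurableSet (ballEvent S u) := by
  simp_rw [ballEvent, Set.ofPred_forall]
  exact .iInter fun e => .iInter fun _ =>
    measurableSet_lt (measurable_slack S u e) (measurable_pi_apply e)

/-- The distances from `u` are recovered by integrating over the times at which the ball around `u`
is a given set. -/
theorem sum_dist_le_sum_volume_waitingTimes {w : Edge n → ℝ} (hw : ∀ e, 0 ≤ w e) (u : Fin n) :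
    ∑ v, ENNReal.ofReal (dist w u v) ≤
      ∑ S : Finset (Fin n) with u ∈ S, (Sᶜ.card : ENNReal) * volume (waitingTimes S u w) := by
  have h1 : ∀ v, ENNReal.ofReal (dist w u v) ≤
      ∑ S : Finset (Fin n) with u ∈ S ∧ v ∉ S, volume (waitingTimes S u w) := by
    intro v
    calc ENNReal.ofReal (dist w u v) = volume (Set.Ico 0 (dist w u v)) := by simp
      _ ≤ volume (⋃ S ∈ ({S | u ∈ S ∧ v ∉ S} : Finset (Finset (Fin n))),
            (fun t => t + -radius S w u) ⁻¹' waitingTimes S u w) := by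
          refine measure_mono fun t ht => ?_
          have hu : u ∈ ball w u t := self_mem_ball w u ht.1
          obtain ⟨h₁, h₂⟩ := radius_le_and_slack_lt_of_ball_eq hw hu rfl
          simp only [Set.mem_iUnion, exists_prop]
          refine ⟨ball w u t, ?_, ?_, ?_⟩
          · simpa [hu, mem_ball] using ht.2
          · linarith
          · simpa only [sub_eq_add_neg] using h₂
      _ ≤ _ := by
          refine (measure_biUnion_finset_le _ _).trans (Finset.sum_le_sum fun S _ => ?_)
          rw [measure_preimage_add_right]
  refine (Finset.sum_le_sum fun v _ => h1 v).trans_eq ?_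
  rw [Finset.sum_comm' (t' := ({S | u ∈ S} : Finset (Finset (Fin n)))) (s' := fun S => Sᶜ)
    (by simp [and_comm])]
  simp

theorem measurableSet_waitingTimes (S : Finset (Fin n)) (u : Fin n) :
    MeasurableSet {x : (Edge n → ℝ) × ℝ | x.2 ∈ waitingTimes S u x.1} := by
  simp_rw [waitingTimes, Set.mem_ofPred_eq, Set.ofPred_and, Set.ofPred_forall]
  refine (measurableSet_le measurable_const measurable_snd).inter
    (.iInter fun e => .iInter fun _ => measurableSet_lt ?_ (by fun_prop))
  exact ((measurable_slack S u e).comp measurable_fst).add measurable_snd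

theorem measurable_volume_waitingTimes (S : Finset (Fin n)) (u : Fin n) :
    Measurable fun w => volume (waitingTimes S u w) :=
  measurable_measure_prodMk_left (measurableSet_waitingTimes S u)

theorem lintegral_volume_waitingTimes_le (S : Finset (Fin n)) (u : Fin n) {c : ℝ} (hc : 0 < c)
    (hcS : c ≤ Fintype.card {e : Edge n // e.fst ∈ S ∧ e.snd ∉ S}) :
    ∫⁻ w, volume (waitingTimes S u w) ∂(weightLaw n) ≤
      ENNReal.ofReal c⁻¹ * weightLaw n (ballEvent S u) := by
  have hA := measurableSet_waitingTimes S u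
  have h1 : ∫⁻ w, volume (waitingTimes S u w) ∂(weightLaw n) =
      ∫⁻ s, weightLaw n {w | s ∈ waitingTimes S u w} :=
    (Measure.prod_apply hA (μ := weightLaw n) (ν := volume)).symm.trans
      (Measure.prod_apply_symm hA)
  have h2 : ∀ s, weightLaw n {w | s ∈ waitingTimes S u w} ≤
      (Set.Ici 0).indicator (fun s => ENNReal.ofReal (Real.exp (-c * s)) *
        weightLaw n (ballEvent S u)) s := by
    intro s
    by_cases hs : 0 ≤ s
    · rw [Set.indicator_of_mem (by exact hs)]
      simp only [waitingTimes, Set.mem_ofPred_eq, hs, true_and]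
      refine (pi_unifLaw_add_lt_le (fun e : Edge n => e.fst ∈ S ∧ e.snd ∉ S) (measurable_slack S u)
        (fun w w' h => slack_congr h u) (fun w e he => slack_nonneg u w he.1) hs).trans ?_
      gcongr ?_ * _
      refine ENNReal.ofReal_le_ofReal (Real.exp_le_exp.2 ?_)
      nlinarith
    · simp [waitingTimes, hs]
  rw [h1]
  refine (lintegral_mono h2).trans_eq ?_
  rw [lintegral_indicator measurableSet_Ici, lintegral_mul_const _ (by fun_prop),
    ← ofReal_integral_eq_lintegral_ofReal, integral_Ici_eq_integral_Ioi,
    integral_exp_mul_Ioi (by linarith)]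
  · simp
  · exact (integrableOn_Ici_iff_integrableOn_Ioi (by simp)).2
      (integrableOn_exp_mul_Ioi (by linarith) 0)
  · exact .of_forall fun s => (Real.exp_pos _).le

/-- Balls around `u` are nested, so at most one of them has `k` elements. -/
theorem sum_weightLaw_ballEvent_le_one (u : Fin n) (k : ℕ) :
    ∑ S : Finset (Fin n) with u ∈ S ∧ S.card = k, weightLaw n (ballEvent S u) ≤ 1 := by
  rw [← measure_biUnion_finset₀]
  · exact prob_le_one
  · intro S hS T hT hne
    simp only [Finset.coe_filter, Finset.mem_univ, true_and, Set.mem_ofPred_eq] at hS hT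
    refine measure_mono_null ?_ (ae_weightLaw_nonneg (n := n))
    intro w hw hnn
    exact hne (eq_of_slack_lt hnn hS.1 hT.1 (hS.2.trans hT.2.symm) hw.1 hw.2)
  · exact fun S _ => (measurableSet_ballEvent S u).nullMeasurableSet

theorem lintegral_sum_dist_le (u : Fin n) :
    ∫⁻ w, ∑ v, ENNReal.ofReal (dist w u v) ∂(weightLaw n) ≤
      ENNReal.ofReal (∑ k ∈ Finset.Icc 1 n, (k : ℝ)⁻¹) := by
  have hterm : ∀ S : Finset (Fin n), u ∈ S →
      (Sᶜ.card : ENNReal) * ∫⁻ w, volume (waitingTimes S u w) ∂(weightLaw n) ≤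
        ENNReal.ofReal (S.card : ℝ)⁻¹ * weightLaw n (ballEvent S u) := by
    intro S hu
    obtain h0 | h0 := Nat.eq_zero_or_pos Sᶜ.card
    · simp [h0]
    have hS : 0 < S.card := Finset.card_pos.2 ⟨u, hu⟩
    have hc : (0 : ℝ) < S.card * Sᶜ.card := by positivity
    have h0' : (Sᶜ.card : ℝ) ≠ 0 := by positivity
    calc (Sᶜ.card : ENNReal) * ∫⁻ w, volume (waitingTimes S u w) ∂(weightLaw n)
        ≤ ENNReal.ofReal Sᶜ.card * (ENNReal.ofReal (S.card * Sᶜ.card : ℝ)⁻¹ *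
            weightLaw n (ballEvent S u)) := by
          rw [ENNReal.ofReal_natCast]
          gcongr
          exact lintegral_volume_waitingTimes_le S u hc
            (by exact_mod_cast card_mul_card_compl_le S)
      _ = _ := by
          rw [← mul_assoc, ← ENNReal.ofReal_mul (by positivity)]
          congr 2
          field_simp
  calc ∫⁻ w, ∑ v, ENNReal.ofReal (dist w u v) ∂(weightLaw n)
      ≤ ∫⁻ w, ∑ S : Finset (Fin n) with u ∈ S,
          (Sᶜ.card : ENNReal) * volume (waitingTimes S u w) ∂(weightLaw n) :=
        lintegral_mono_ae (ae_weightLaw_nonneg.mono fun w hw =>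
          sum_dist_le_sum_volume_waitingTimes hw u)
    _ ≤ ∑ S : Finset (Fin n) with u ∈ S,
          (Sᶜ.card : ENNReal) * ∫⁻ w, volume (waitingTimes S u w) ∂(weightLaw n) := by
        rw [lintegral_finsetSum _ fun S _ =>
          (measurable_volume_waitingTimes S u).const_mul _]
        refine Finset.sum_le_sum fun S _ => ?_
        rw [lintegral_const_mul _ (measurable_volume_waitingTimes S u)]
    _ ≤ ∑ S : Finset (Fin n) with u ∈ S,
          ENNReal.ofReal (S.card : ℝ)⁻¹ * weightLaw n (ballEvent S u) :=
        Finset.sum_le_sum fun S hS => hterm S (by simpa using hS)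
    _ = ∑ k ∈ Finset.Icc 1 n, ENNReal.ofReal (k : ℝ)⁻¹ *
          ∑ S : Finset (Fin n) with u ∈ S ∧ S.card = k, weightLaw n (ballEvent S u) := by
        rw [← Finset.sum_fiberwise_of_maps_to (t := Finset.Icc 1 n) (g := Finset.card)]
        · refine Finset.sum_congr rfl fun k _ => ?_
          rw [Finset.mul_sum, Finset.filter_filter]
          refine Finset.sum_congr rfl fun S hS => ?_
          rw [(Finset.mem_filter.1 hS).2.2]
        · intro S hS
          simp only [Finset.mem_filter, Finset.mem_univ, true_and] at hS
          exact Finset.mem_Icc.2 ⟨Finset.card_pos.2 ⟨u, hS⟩, by simpa using S.card_le_univ⟩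
    _ ≤ ∑ k ∈ Finset.Icc 1 n, ENNReal.ofReal (k : ℝ)⁻¹ * 1 := by
        gcongr
        exact sum_weightLaw_ballEvent_le_one u _
    _ = _ := by
        simp_rw [mul_one]
        rw [ENNReal.ofReal_sum_of_nonneg fun k _ => by positivity]

/-! ### Integrability of functions of finitely many events -/

theorem measurable_comp_of_finite {α ι β : Type*} [MeasurableSpace α] [Finite ι]
    [MeasurableSpace β] {g : α → Set ι} (hg : ∀ i, MeasurableSet {a | i ∈ g a}) (F : Set ι → β) :
    Measurable fun a => F (g a) := by
  have : DiscreteMeasurableSpace (Set ι) :=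
    inferInstanceAs (DiscreteMeasurableSpace (ι → Prop))
  have hg' : Measurable g := measurable_set_iff.2 fun i => measurableSet_setOfPred.1 (hg i)
  exact Measurable.of_discrete.comp hg'

theorem integrable_comp_of_finite {α ι : Type*} [MeasurableSpace α] [Finite ι]
    {μ : Measure α} [IsFiniteMeasure μ] {g : α → Set ι} (hg : ∀ i, MeasurableSet {a | i ∈ g a})
    (F : Set ι → ℝ) : Integrable (fun a => F (g a)) μ := by
  obtain ⟨C, hC⟩ := (Set.finite_range fun A => ‖F A‖).bddAbove
  exact .of_bound (measurable_comp_of_finite hg F).aestronglyMeasurable C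
    (.of_forall fun a => hC ⟨g a, rfl⟩)

theorem measurableSet_isShortest {u v : Fin n} (p : PathBetween n u v) :
    MeasurableSet {w : Edge n → ℝ | IsShortest w p} := by
  simp_rw [IsShortest, Set.ofPred_forall]
  exact .iInter fun q => measurableSet_le (measurable_pathWeight p) (measurable_pathWeight q)

theorem measurableSet_mem_SP (π : DiPath n) : MeasurableSet {w : Edge n → ℝ | π ∈ SP w} :=
  measurableSet_isShortest π.2.2

theorem measurableSet_mem_SPThrough (π : DiPath n) :
    MeasurableSet {x : (Edge n → ℝ) × Edge n | π ∈ SPThrough x.1 x.2} :=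
  (measurable_fst (measurableSet_isShortest π.2.2)).inter
    (measurable_snd (MeasurableSet.of_discrete (s := {e | e ∈ edgesOf π.2.2})))

theorem measurable_newWeights : Measurable (newWeights (n := n)) := by
  refine measurable_pi_iff.2 fun e => ?_
  simp_rw [newWeights, Function.update_apply]
  refine Measurable.ite ?_ (by fun_prop) (by fun_prop)
  exact (measurable_fst.comp measurable_snd : Measurable fun ω : UpdateSpace n => ω.2.1)
    (MeasurableSet.of_discrete (s := {f | e = f}))

theorem measurableSet_mem_SPThrough_old (π : DiPath n) :
    MeasurableSet {ω : UpdateSpace n | π ∈ SPThrough (oldWeights ω) (updatedEdge ω)} :=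
  (measurable_fst.prodMk (measurable_fst.comp measurable_snd)) (measurableSet_mem_SPThrough π)

theorem measurableSet_mem_SPThrough_new (π : DiPath n) :
    MeasurableSet {ω : UpdateSpace n | π ∈ SPThrough (newWeights ω) (updatedEdge ω)} :=
  (measurable_newWeights.prodMk (measurable_fst.comp measurable_snd))
    (measurableSet_mem_SPThrough π)

theorem integrable_hopCount (u v : Fin n) :
    Integrable (fun w : Edge n → ℝ => (hopCount w u v : ℝ)) (weightLaw n) :=
  integrable_comp_of_finite (g := SP) measurableSet_mem_SP fun A =>
    ((sInf {k | ∃ p : PathBetween n u v,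
      (⟨u, v, p⟩ : DiPath n) ∈ A ∧ (edgesOf p).length = k} : ℕ) : ℝ)

theorem nonempty_edge (hn : 2 ≤ n) : Nonempty (Edge n) :=
  ⟨⟨(⟨0, by lia⟩, ⟨1, by lia⟩), by simp⟩⟩

theorem isProbabilityMeasure_edgeLaw (hn : 2 ≤ n) : IsProbabilityMeasure (edgeLaw n) :=
  have := nonempty_edge hn
  ProbabilityTheory.isProbabilityMeasure_uniformOn Set.finite_univ Set.univ_nonempty

theorem isProbabilityMeasure_graphEdgeLaw (hn : 2 ≤ n) : IsProbabilityMeasure (graphEdgeLaw n) := by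
  have := isProbabilityMeasure_edgeLaw hn
  unfold graphEdgeLaw
  infer_instance

theorem isProbabilityMeasure_updateLaw (hn : 2 ≤ n) : IsProbabilityMeasure (updateLaw n) := by
  have := isProbabilityMeasure_edgeLaw hn
  unfold updateLaw
  infer_instance

theorem integrable_numThrough (hn : 2 ≤ n) : Integrable (numThrough (n := n)) (graphEdgeLaw n) :=
  have := isProbabilityMeasure_graphEdgeLaw hn
  integrable_comp_of_finite measurableSet_mem_SPThrough fun A => (A.ncard : ℝ)

theorem integrable_hopCountRandomPair (hn : 2 ≤ n) :
    Integrable (hopCountRandomPair (n := n)) (graphEdgeLaw n) := by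
  have := isProbabilityMeasure_graphEdgeLaw hn
  refine (integrable_comp_of_finite (ι := DiPath n)
    (g := fun x : (Edge n → ℝ) × Edge n => {π | π ∈ SP x.1 ∧ π.1 = x.2.fst ∧ π.2.1 = x.2.snd})
    (fun π => (measurable_fst (measurableSet_mem_SP π)).inter (measurable_snd
      (MeasurableSet.of_discrete (s := {e : Edge n | π.1 = e.fst ∧ π.2.1 = e.snd}))))
    (fun A => ((sInf {k | ∃ π ∈ A, (edgesOf π.2.2).length = k} : ℕ) : ℝ))).congr
      (.of_forall fun x => ?_)
  simp only [hopCountRandomPair, hopCount]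
  congr 2
  ext k
  constructor
  · rintro ⟨⟨u, v, p⟩, ⟨hp, rfl, rfl⟩, hk⟩
    exact ⟨p, hp, hk⟩
  · rintro ⟨p, hp, hk⟩
    exact ⟨⟨_, _, p⟩, ⟨hp, rfl, rfl⟩, hk⟩

theorem integrable_ncard_SPThrough_old (hn : 2 ≤ n) :
    Integrable (fun ω : UpdateSpace n => ((SPThrough (oldWeights ω) (updatedEdge ω)).ncard : ℝ))
      (updateLaw n) :=
  have := isProbabilityMeasure_updateLaw hn
  integrable_comp_of_finite measurableSet_mem_SPThrough_old fun A => (A.ncard : ℝ)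

theorem integrable_ncard_SPThrough_new (hn : 2 ≤ n) :
    Integrable (fun ω : UpdateSpace n => ((SPThrough (newWeights ω) (updatedEdge ω)).ncard : ℝ))
      (updateLaw n) :=
  have := isProbabilityMeasure_updateLaw hn
  integrable_comp_of_finite measurableSet_mem_SPThrough_new fun A => (A.ncard : ℝ)

theorem integrable_numDestroyed (hn : 2 ≤ n) : Integrable (numDestroyed (n := n)) (updateLaw n) :=
  have := isProbabilityMeasure_updateLaw hn
  integrable_comp_of_finite (fun π => (measurableSet_mem_SPThrough_old π).union
    ((measurable_fst (measurableSet_mem_SP π)).diff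
      (measurable_newWeights (measurableSet_mem_SP π)))) fun A => (A.ncard : ℝ)

theorem integrable_numCreated (hn : 2 ≤ n) : Integrable (numCreated (n := n)) (updateLaw n) :=
  have := isProbabilityMeasure_updateLaw hn
  integrable_comp_of_finite (fun π => (measurableSet_mem_SPThrough_new π).union
    ((measurable_newWeights (measurableSet_mem_SP π)).diff
      (measurable_fst (measurableSet_mem_SP π)))) fun A => (A.ncard : ℝ)

/-! ### Reversing an update -/

/-- Exchanging one coordinate of a random vector with an independent variable of the same law. -/
theorem measurePreserving_update_swap {ι : Type*} [Fintype ι] [DecidableEq ι] (μ : Measure ℝ)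
    [IsProbabilityMeasure μ] (i : ι) :
    MeasurePreserving (fun x : (ι → ℝ) × ℝ => (Function.update x.1 i x.2, x.1 i))
      ((Measure.pi fun _ => μ).prod μ) ((Measure.pi fun _ => μ).prod μ) := by
  have hm : Measurable fun x : (ι → ℝ) × ℝ => (Function.update x.1 i x.2, x.1 i) := by
    refine Measurable.prodMk ?_ (by fun_prop)
    exact measurable_update'.comp (measurable_fst.prodMk measurable_snd)
  refine ⟨hm, (Measure.prod_eq_generateFrom generateFrom_pi
    MeasurableSpace.generateFrom_measurableSet isPiSystem_pi
    MeasurableSpace.isPiSystem_measurableSet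
    (Measure.FiniteSpanningSetsIn.pi fun _ => μ.toFiniteSpanningSetsIn)
    μ.toFiniteSpanningSetsIn ?_).symm⟩
  rintro _ ⟨s, hs, rfl⟩ t ht
  have hs' : ∀ j, MeasurableSet (s j) := fun j => hs j (Set.mem_univ j)
  have hpre : (fun x : (ι → ℝ) × ℝ => (Function.update x.1 i x.2, x.1 i)) ⁻¹'
      (Set.univ.pi s ×ˢ t) = Set.univ.pi (Function.update s i t) ×ˢ s i := by
    ext ⟨w, x⟩
    simp only [Set.mem_preimage, Set.mem_prod, Set.mem_pi, Set.mem_univ, true_imp_iff]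
    constructor
    · rintro ⟨h₁, h₂⟩
      refine ⟨fun j => ?_, by simpa using h₁ i⟩
      by_cases hj : j = i
      · subst hj
        simpa using h₂
      · simpa [hj] using h₁ j
    · rintro ⟨h₁, h₂⟩
      refine ⟨fun j => ?_, by simpa using h₁ i⟩
      by_cases hj : j = i
      · subst hj
        simpa using h₂
      · simpa [hj] using h₁ j
  rw [Measure.map_apply hm ((MeasurableSet.univ_pi hs').prod ht), hpre, Measure.prod_prod,
    Measure.pi_pi, Measure.pi_pi,
    ← Finset.mul_prod_erase _ _ (Finset.mem_univ i),
    ← Finset.mul_prod_erase (Finset.univ) (fun j => μ (s j)) (Finset.mem_univ i)]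
  have hprod : ∏ j ∈ Finset.univ.erase i, μ (Function.update s i t j) =
      ∏ j ∈ Finset.univ.erase i, μ (s j) :=
    Finset.prod_congr rfl fun j hj => by rw [Function.update_of_ne (Finset.ne_of_mem_erase hj)]
  rw [hprod, Function.update_self]
  ring

/-- The update that undoes `ω`: the updated edge gets its old weight back. -/
def reverseUpdate (ω : UpdateSpace n) : UpdateSpace n :=
  (newWeights ω, ω.2.1, ω.1 ω.2.1)

/-- A random update and its reversal have the same law. -/
theorem measurePreserving_reverseUpdate (hn : 2 ≤ n) :
    MeasurePreserving (reverseUpdate (n := n)) (updateLaw n) (updateLaw n) := by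
  have := isProbabilityMeasure_edgeLaw hn
  -- The updated edge is listed first, so that the reversal becomes a skew product over it.
  have hρ : MeasurePreserving (fun ω : UpdateSpace n => (ω.2.1, (ω.1, ω.2.2))) (updateLaw n)
      ((edgeLaw n).prod ((weightLaw n).prod unifLaw)) :=
    (measurePreserving_prodAssoc _ _ _).comp ((Measure.measurePreserving_swap.prod
      (.id unifLaw)).comp ((measurePreserving_prodAssoc (weightLaw n) (edgeLaw n) unifLaw).symm _))
  have hρ' : MeasurePreserving (fun x : Edge n × (Edge n → ℝ) × ℝ => (x.2.1, (x.1, x.2.2)))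
      ((edgeLaw n).prod ((weightLaw n).prod unifLaw)) (updateLaw n) :=
    (measurePreserving_prodAssoc _ _ _).comp ((Measure.measurePreserving_swap.prod
      (.id unifLaw)).comp ((measurePreserving_prodAssoc (edgeLaw n) (weightLaw n) unifLaw).symm _))
  refine hρ'.comp (MeasurePreserving.comp (MeasurePreserving.skew_product (.id (edgeLaw n))
    (g := fun e x => (Function.update x.1 e x.2, x.1 e)) ?_
    (.of_forall fun e => (measurePreserving_update_swap unifLaw e).map_eq)) hρ)
  exact measurable_from_prod_countable_right fun e =>
    (measurePreserving_update_swap unifLaw e).measurable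

theorem newWeights_reverseUpdate (ω : UpdateSpace n) :
    newWeights (reverseUpdate ω) = oldWeights ω := by
  simp [newWeights, reverseUpdate, oldWeights]

theorem integral_comp_reverseUpdate (hn : 2 ≤ n) {f : UpdateSpace n → ℝ}
    (hf : Integrable f (updateLaw n)) :
    ∫ ω, f (reverseUpdate ω) ∂(updateLaw n) = ∫ ω, f ω ∂(updateLaw n) := by
  have h := measurePreserving_reverseUpdate hn
  rw [← integral_map h.measurable.aemeasurable (by rw [h.map_eq]; exact hf.1), h.map_eq]

theorem integral_numDestroyed_eq_integral_numCreated (hn : 2 ≤ n) :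
    ∫ ω, numDestroyed ω ∂(updateLaw n) = ∫ ω, numCreated ω ∂(updateLaw n) := by
  rw [← integral_comp_reverseUpdate hn (integrable_numDestroyed hn)]
  refine integral_congr_ae (.of_forall fun ω => ?_)
  simp only [numDestroyed, newWeights_reverseUpdate]
  rfl

/-! ### Destroyed paths and paths through the updated edge -/

theorem IsShortest.of_le {w : Edge n → ℝ} {u v : Fin n} {p q : PathBetween n u v}
    (hp : IsShortest w p) (h : pathWeight w q ≤ pathWeight w p) : IsShortest w q :=
  fun r => h.trans (hp r)

theorem pathWeight_update_of_notMem {w : Edge n → ℝ} {e : Edge n} (x : ℝ) {u v : Fin n}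
    {p : PathBetween n u v} (h : e ∉ edgesOf p) :
    pathWeight (Function.update w e x) p = pathWeight w p := by
  unfold pathWeight
  congr 1
  refine List.map_congr_left fun f hf => Function.update_of_ne ?_ _ _
  rintro rfl
  exact h hf

/-- If a shortest path that avoids the updated edge stops being shortest, then every new shortest
path with the same endpoints passes through that edge. -/
theorem ncard_SPDestroyed_le {w : Edge n → ℝ} (e : Edge n) (x : ℝ)
    (huniq : ∀ (u v : Fin n) (p q : PathBetween n u v), IsShortest w p → IsShortest w q → p = q) :
    (SPDestroyed w (Function.update w e x) e).ncard ≤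
      (SPThrough w e).ncard + (SPThrough (Function.update w e x) e).ncard := by
  set w' := Function.update w e x with hw'
  have hunion : SPDestroyed w w' e = SPThrough w e ∪ ((SP w \ SP w') \ SPThrough w e) :=
    Set.union_sdiff_self.symm
  rw [hunion]
  refine (Set.ncard_union_le _ _).trans (Nat.add_le_add_left ?_ _)
  choose P hP using fun u v => exists_isShortest w' u v
  refine Set.ncard_le_ncard_of_injOn (fun π => ⟨π.1, π.2.1, P π.1 π.2.1⟩) ?_ ?_
  · rintro ⟨u, v, p⟩ ⟨⟨hp, hp'⟩, hpe⟩
    refine ⟨hP u v, ?_⟩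
    by_contra hPe
    refine hp' ((hP u v).of_le ?_)
    have hpe' : e ∉ edgesOf p := fun h => hpe ⟨hp, h⟩
    have h₁ : pathWeight w' p = pathWeight w p := pathWeight_update_of_notMem x hpe'
    have h₂ : pathWeight w' (P u v) = pathWeight w (P u v) := pathWeight_update_of_notMem x hPe
    rw [h₁, h₂]
    exact hp _
  · rintro ⟨u, v, p⟩ ⟨⟨hp, -⟩, -⟩ ⟨u', v', p'⟩ ⟨⟨hp', -⟩, -⟩ h
    obtain rfl : u = u' := congrArg Sigma.fst h
    obtain rfl : v = v' := congrArg (fun π : DiPath n => π.2.1) h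
    rw [huniq u v p p' hp hp']

theorem integral_numDestroyed_le (hn : 2 ≤ n) :
    ∫ ω, numDestroyed ω ∂(updateLaw n) ≤ 2 * ∫ x, numThrough x ∂(graphEdgeLaw n) := by
  have := isProbabilityMeasure_edgeLaw hn
  have hold := integrable_ncard_SPThrough_old hn
  have hnew := integrable_ncard_SPThrough_new hn
  have h₁ : ∫ ω, ((SPThrough (newWeights ω) (updatedEdge ω)).ncard : ℝ) ∂(updateLaw n) =
      ∫ ω, ((SPThrough (oldWeights ω) (updatedEdge ω)).ncard : ℝ) ∂(updateLaw n) :=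
    integral_comp_reverseUpdate hn hold
  have hfst : MeasurePreserving (fun ω : UpdateSpace n => (ω.1, ω.2.1)) (updateLaw n)
      (graphEdgeLaw n) :=
    (MeasurePreserving.id (weightLaw n)).prod measurePreserving_fst
  have h₂ : ∫ ω, ((SPThrough (oldWeights ω) (updatedEdge ω)).ncard : ℝ) ∂(updateLaw n) =
      ∫ x, numThrough x ∂(graphEdgeLaw n) := by
    rw [← hfst.map_eq, integral_map hfst.measurable.aemeasurable]
    · rfl
    · rw [hfst.map_eq]
      exact (integrable_numThrough hn).1
  calc ∫ ω, numDestroyed ω ∂(updateLaw n)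
      ≤ ∫ ω, (((SPThrough (oldWeights ω) (updatedEdge ω)).ncard : ℝ) +
          (SPThrough (newWeights ω) (updatedEdge ω)).ncard) ∂(updateLaw n) := by
        refine integral_mono_ae (integrable_numDestroyed hn) (hold.add hnew) ?_
        have hq : Measure.QuasiMeasurePreserving (Prod.fst : UpdateSpace n → _) (updateLaw n)
            (weightLaw n) := Measure.quasiMeasurePreserving_fst
        filter_upwards [hq.ae ae_isShortest_unique] with ω hω
        have h := ncard_SPDestroyed_le ω.2.1 ω.2.2 hω
        exact (Nat.cast_le.2 h).trans_eq (Nat.cast_add _ _)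
    _ = _ := by
        rw [integral_add hold hnew, h₁, h₂, two_mul]

/-! ### Paths through a random edge and edges on a random shortest path -/

theorem hopCount_eq_of_unique {w : Edge n → ℝ} {u v : Fin n} {p : PathBetween n u v}
    (huniq : ∀ q : PathBetween n u v, IsShortest w q → q = p) :
    hopCount w u v = (edgesOf p).length := by
  obtain ⟨q, hq, hlen⟩ := exists_isShortest_length_eq_hopCount w u v
  rw [← hlen, huniq q hq]

theorem hopCount_self (w : Edge n → ℝ) (u : Fin n) : hopCount w u u = 0 := by
  obtain ⟨p, -, hlen⟩ := exists_isShortest_length_eq_hopCount w u u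
  rw [← hlen, edgesOf, (SimpleGraph.Walk.isPath_iff_nil.1 p.2).eq_nil]
  rfl

/-- A sum over the edges is a sum over the ordered pairs of vertices without the diagonal. -/
theorem sum_edge_eq (f : Fin n → Fin n → ℝ) :
    ∑ e : Edge n, f e.fst e.snd = ∑ u, ∑ v, if u = v then 0 else f u v := by
  rw [← Finset.sum_product', Finset.univ_product_univ]
  have hite : ∀ x : Fin n × Fin n, (if x.1 = x.2 then 0 else f x.1 x.2) =
      if x.1 ≠ x.2 then f x.1 x.2 else 0 := fun x => (ite_not _ _ _).symm
  simp_rw [hite]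
  rw [← Finset.sum_filter]
  refine Finset.sum_bij (fun e _ => e.toProd) ?_ ?_ ?_ ?_
  · intro e _
    simp
  · intro e _ e' _ h
    exact SimpleGraph.Dart.ext _ _ h
  · intro x hx
    exact ⟨⟨x, by simpa using hx⟩, Finset.mem_univ _, rfl⟩
  · intro e _
    rfl

/-- Double counting of the pairs of a shortest path and one of its edges. -/
theorem sum_ncard_SPThrough {w : Edge n → ℝ}
    (huniq : ∀ (u v : Fin n) (p q : PathBetween n u v), IsShortest w p → IsShortest w q → p = q) :
    ∑ e, ((SPThrough w e).ncard : ℝ) = ∑ e : Edge n, (hopCount w e.fst e.snd : ℝ) := by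
  choose P hP using fun u v => exists_isShortest w u v
  have h₁ : ∀ e, (SPThrough w e).ncard =
      (({x | e ∈ edgesOf (P x.1 x.2)} : Finset (Fin n × Fin n))).card := by
    intro e
    have hinj : Function.Injective fun x : Fin n × Fin n => (⟨x.1, x.2, P x.1 x.2⟩ : DiPath n) :=
      fun x y h => Prod.ext (congrArg Sigma.fst h) (congrArg (fun π : DiPath n => π.2.1) h)
    rw [← Set.ncard_coe_finset, ← Set.ncard_image_of_injective _ hinj]
    congr 1
    ext ⟨u, v, p⟩
    simp only [Finset.coe_filter, Finset.mem_univ, true_and, Set.mem_image, Set.mem_ofPred_eq]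
    constructor
    · rintro ⟨hp, he⟩
      obtain rfl := huniq u v p (P u v) hp (hP u v)
      exact ⟨(u, v), he, rfl⟩
    · rintro ⟨⟨u', v'⟩, he, h⟩
      rw [← h]
      exact ⟨hP u' v', he⟩
  have h₂ : ∀ u v, (hopCount w u v : ℝ) = ∑ e, if e ∈ edgesOf (P u v) then 1 else 0 := by
    intro u v
    rw [hopCount_eq_of_unique fun q hq => huniq u v q (P u v) hq (hP u v),
      ← List.toFinset_card_of_nodup (edgesOf_nodup _), Finset.card_eq_sum_ones,
      ← Finset.sum_filter]
    push_cast
    congr 1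
    ext e
    simp
  rw [sum_edge_eq fun u v => (hopCount w u v : ℝ)]
  have h₃ : ∀ u v, (if u = v then (0 : ℝ) else hopCount w u v) = hopCount w u v := by
    intro u v
    split_ifs with h
    · rw [h, hopCount_self, Nat.cast_zero]
    · rfl
  simp_rw [h₃, h₂, h₁, Finset.card_filter]
  push_cast
  simp_rw [Fintype.sum_prod_type]
  rw [Finset.sum_comm]
  exact Finset.sum_congr rfl fun u _ => Finset.sum_comm

theorem integral_edgeLaw (f : Edge n → ℝ) :
    ∫ e, f e ∂(edgeLaw n) = (Fintype.card (Edge n) : ℝ)⁻¹ * ∑ e, f e := by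
  rw [edgeLaw, ProbabilityTheory.uniformOn, ProbabilityTheory.cond, Measure.restrict_univ,
    integral_smul_measure, integral_count, Measure.count_apply_finite _ Set.finite_univ]
  simp

theorem integral_graphEdgeLaw (hn : 2 ≤ n) {f : (Edge n → ℝ) × Edge n → ℝ}
    (hf : Integrable f (graphEdgeLaw n)) :
    ∫ x, f x ∂(graphEdgeLaw n) =
      (Fintype.card (Edge n) : ℝ)⁻¹ * ∫ w, ∑ e, f (w, e) ∂(weightLaw n) := by
  have := isProbabilityMeasure_edgeLaw hn
  rw [graphEdgeLaw, integral_prod _ hf, ← integral_const_mul]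
  simp_rw [integral_edgeLaw]

theorem integral_numThrough_eq_integral_hopCountRandomPair (hn : 2 ≤ n) :
    ∫ x, numThrough x ∂(graphEdgeLaw n) = ∫ x, hopCountRandomPair x ∂(graphEdgeLaw n) := by
  rw [integral_graphEdgeLaw hn (integrable_numThrough hn),
    integral_graphEdgeLaw hn (integrable_hopCountRandomPair hn)]
  congr 1
  exact integral_congr_ae (ae_isShortest_unique.mono fun w hw => sum_ncard_SPThrough hw)

/-! ### Exponential moments over all paths -/

theorem integral_exp_unifLaw_le {θ : ℝ} (hθ : 0 < θ) :
    ∫ x, Real.exp (-θ * x) ∂unifLaw ≤ θ⁻¹ := by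
  calc ∫ x, Real.exp (-θ * x) ∂unifLaw
      ≤ ∫ x in Set.Ici 0, Real.exp (-θ * x) :=
        setIntegral_mono_set ((integrableOn_Ici_iff_integrableOn_Ioi (by simp)).2
          (integrableOn_exp_mul_Ioi (by linarith) 0)) (.of_forall fun x => (Real.exp_pos _).le)
          (.of_forall fun x hx => hx.1)
    _ = θ⁻¹ := by
        rw [integral_Ici_eq_integral_Ioi, integral_exp_mul_Ioi (by linarith)]
        simp

theorem integrable_exp_pathWeight {θ : ℝ} (hθ : 0 < θ) {u v : Fin n} (p : PathBetween n u v) :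
    Integrable (fun w => Real.exp (-θ * pathWeight w p)) (weightLaw n) := by
  refine .of_bound ((measurable_pathWeight p).const_mul _).exp.aestronglyMeasurable 1 ?_
  filter_upwards [ae_weightLaw_nonneg] with w hw
  rw [Real.norm_eq_abs, Real.abs_exp, Real.exp_le_one_iff]
  nlinarith [pathWeight_nonneg hw p]

theorem integral_exp_pathWeight_le {θ : ℝ} (hθ : 0 < θ) {u v : Fin n} (p : PathBetween n u v) :
    ∫ w, Real.exp (-θ * pathWeight w p) ∂(weightLaw n) ≤ θ⁻¹ ^ (edgesOf p).length := by
  have h₁ : ∀ w : Edge n → ℝ, Real.exp (-θ * pathWeight w p) =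
      ∏ e, if e ∈ edgesOf p then Real.exp (-θ * w e) else 1 := fun w => by
    rw [pathWeight_eq_sum, Finset.mul_sum, Real.exp_sum]
    refine Finset.prod_congr rfl fun e _ => ?_
    split_ifs <;> simp
  have h₂ := integral_fintype_prod_eq_prod (μ := fun _ : Edge n => unifLaw)
    (fun (e : Edge n) (x : ℝ) => if e ∈ edgesOf p then Real.exp (-θ * x) else 1)
  simp_rw [h₁]
  rw [weightLaw, h₂]
  have h₃ : ∀ e : Edge n, (∫ x, (if e ∈ edgesOf p then Real.exp (-θ * x) else 1) ∂unifLaw) =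
      if e ∈ (edgesOf p).toFinset then ∫ x, Real.exp (-θ * x) ∂unifLaw else 1 := fun e => by
    simp only [List.mem_toFinset]
    split_ifs <;> simp
  simp_rw [h₃]
  rw [Finset.prod_ite_mem, Finset.univ_inter, Finset.prod_const,
    List.toFinset_card_of_nodup (edgesOf_nodup p)]
  exact pow_le_pow_left₀ (integral_nonneg fun x => (Real.exp_pos _).le)
    (integral_exp_unifLaw_le hθ) _

noncomputable instance instFintypePathBetween (u v : Fin n) : Fintype (PathBetween n u v) :=
  Fintype.ofFinite _

theorem eq_of_support_eq {x y : Σ e : Edge n, PathBetween n e.fst e.snd}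
    (h : x.2.1.support = y.2.1.support) : x = y := by
  obtain ⟨e, p⟩ := x
  obtain ⟨e', p'⟩ := y
  have h' : p.1.support = p'.1.support := h
  have h₁ : e.fst = e'.fst := by
    have := congrArg List.head? h'
    rwa [List.head?_eq_some_head p.1.support_ne_nil, List.head?_eq_some_head p'.1.support_ne_nil,
      p.1.head_support, p'.1.head_support, Option.some_inj] at this
  have h₂ : e.snd = e'.snd := by
    have := congrArg List.getLast? h'
    rwa [List.getLast?_eq_some_getLast p.1.support_ne_nil,
      List.getLast?_eq_some_getLast p'.1.support_ne_nil,
      p.1.getLast_support, p'.1.getLast_support, Option.some_inj] at this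
  obtain rfl : e = e' := SimpleGraph.Dart.ext _ _ (Prod.ext h₁ h₂)
  rw [Subtype.ext (SimpleGraph.Walk.ext_support h')]

/-- A nontrivial path with `k` edges is determined by the list of its `k + 1` vertices. -/
theorem card_length_eq_le (k : ℕ) :
    (({x | (edgesOf x.2).length = k} : Finset (Σ e : Edge n, PathBetween n e.fst e.snd))).card ≤
      n ^ (k + 1) := by
  have hlen : ∀ x : {x : Σ e : Edge n, PathBetween n e.fst e.snd // (edgesOf x.2).length = k},
      x.1.2.1.support.length = k + 1 := fun x => by
    rw [SimpleGraph.Walk.length_support, ← SimpleGraph.Walk.length_darts]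
    exact congrArg (· + 1) x.2
  have h := Fintype.card_le_of_injective (β := List.Vector (Fin n) (k + 1))
    (fun x => ⟨x.1.2.1.support, hlen x⟩)
    fun x y h => Subtype.ext (eq_of_support_eq (congrArg Subtype.val h))
  rwa [Fintype.card_subtype, card_vector, Fintype.card_fin] at h

/-- The generating function of all nontrivial paths by their number of edges, rescaled so that it is
bounded by `n` times a geometric series. -/
theorem sum_pow_length_le {r : ℝ} (hr : 0 ≤ r) (hr1 : r < 1) :
    ∑ e : Edge n, ∑ p : PathBetween n e.fst e.snd, (r / n) ^ (edgesOf p).length ≤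
      n * (1 - r)⁻¹ := by
  obtain rfl | hn := Nat.eq_zero_or_pos n
  · have : IsEmpty (Edge 0) := ⟨fun e => e.fst.elim0⟩
    rw [Finset.univ_eq_empty, Finset.sum_empty]
    simp
  let X := Σ e : Edge n, PathBetween n e.fst e.snd
  have hmaps : ∀ x ∈ (Finset.univ : Finset X), (edgesOf x.2).length ∈ Finset.range n := by
    intro x _
    have := x.2.2.length_lt
    rw [Fintype.card_fin] at this
    rwa [Finset.mem_range, edgesOf, SimpleGraph.Walk.length_darts]
  have hn' : (n : ℝ) ≠ 0 := by positivity
  calc ∑ e : Edge n, ∑ p : PathBetween n e.fst e.snd, (r / n) ^ (edgesOf p).length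
      = ∑ x : X, (r / n) ^ (edgesOf x.2).length :=
        (Fintype.sum_sigma fun x : X => (r / n) ^ (edgesOf x.2).length).symm
    _ = ∑ k ∈ Finset.range n, ∑ x : X with (edgesOf x.2).length = k,
          (r / n) ^ (edgesOf x.2).length := (Finset.sum_fiberwise_of_maps_to hmaps _).symm
    _ ≤ ∑ k ∈ Finset.range n, n * r ^ k := by
        refine Finset.sum_le_sum fun k _ => ?_
        have hk : ∑ x : X with (edgesOf x.2).length = k, (r / n) ^ (edgesOf x.2).length =
            (({x | (edgesOf x.2).length = k} : Finset X)).card * (r / n) ^ k := by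
          rw [← nsmul_eq_mul, ← Finset.sum_const]
          exact Finset.sum_congr rfl fun x hx => by rw [(Finset.mem_filter.1 hx).2]
        rw [hk]
        calc ((({x | (edgesOf x.2).length = k} : Finset X)).card : ℝ) * (r / n) ^ k
            ≤ (n : ℝ) ^ (k + 1) * (r / n) ^ k := by
              gcongr
              exact_mod_cast card_length_eq_le k
          _ = n * r ^ k := by
              rw [div_pow, pow_succ]
              field_simp
    _ ≤ n * (1 - r)⁻¹ := by
        rw [← Finset.mul_sum, ← tsum_geometric_of_lt_one hr hr1]
        gcongr
        exact (summable_geometric_of_lt_one hr hr1).sum_le_tsum _ fun k _ => by positivity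

/-! ### Comparing the number of edges with the distance -/

theorem integrable_dist (u v : Fin n) :
    Integrable (fun w : Edge n → ℝ => dist w u v) (weightLaw n) := by
  refine (lintegral_ofReal_ne_top_iff_integrable
    (measurable_distIn _ u v).aestronglyMeasurable
    (ae_weightLaw_nonneg.mono fun w hw => dist_nonneg hw u v)).1 (ne_top_of_le_ne_top
      (ENNReal.ofReal_ne_top) ((lintegral_mono fun w => ?_).trans (lintegral_sum_dist_le u)))
  exact Finset.single_le_sum (f := fun v => ENNReal.ofReal (dist w u v)) (fun _ _ => zero_le)
    (Finset.mem_univ v)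

theorem sum_integral_dist_le (u : Fin n) :
    ∑ v, ∫ w, dist w u v ∂(weightLaw n) ≤ 1 + Real.log n := by
  have hnn : ∀ v, 0 ≤ᵐ[weightLaw n] fun w => dist w u v := fun v =>
    ae_weightLaw_nonneg.mono fun w hw => dist_nonneg hw u v
  have hle : ∑ v, ∫ w, dist w u v ∂(weightLaw n) ≤ ∑ k ∈ Finset.Icc 1 n, (k : ℝ)⁻¹ := by
    rw [← ENNReal.ofReal_le_ofReal_iff (Finset.sum_nonneg fun k _ => by positivity),
      ENNReal.ofReal_sum_of_nonneg fun v _ => integral_nonneg_of_ae (hnn v)]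
    refine le_trans (le_of_eq ?_) (lintegral_sum_dist_le u)
    rw [lintegral_finsetSum _ fun v _ => (measurable_distIn _ u v).ennreal_ofReal]
    exact Finset.sum_congr rfl fun v _ =>
      ofReal_integral_eq_lintegral_ofReal (integrable_dist u v) (hnn v)
  refine hle.trans ?_
  have := harmonic_le_one_add_log n
  rwa [harmonic_eq_sum_Icc, Rat.cast_sum, Finset.sum_congr rfl fun k _ => by push_cast; rfl]
    at this

theorem sum_edge_integral_dist_le :
    ∑ e : Edge n, ∫ w, dist w e.fst e.snd ∂(weightLaw n) ≤ n * (1 + Real.log n) := by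
  rw [sum_edge_eq fun u v => ∫ w, dist w u v ∂(weightLaw n)]
  calc ∑ u : Fin n, ∑ v, (if u = v then 0 else ∫ w, dist w u v ∂(weightLaw n))
      ≤ ∑ u : Fin n, ∑ v, ∫ w, dist w u v ∂(weightLaw n) := by
        gcongr with u _ v _
        split_ifs
        · exact integral_nonneg_of_ae (ae_weightLaw_nonneg.mono fun w hw => dist_nonneg hw u v)
        · exact le_rfl
    _ ≤ ∑ _u : Fin n, (1 + Real.log n) := Finset.sum_le_sum fun u _ => sum_integral_dist_le u
    _ = _ := by simp [mul_add]

theorem card_edge : (Fintype.card (Edge n) : ℝ) = n * (n - 1) := by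
  have h := sum_edge_eq (n := n) fun _ _ => 1
  simp only [Finset.sum_const, Finset.card_univ, nsmul_eq_mul, mul_one] at h
  rw [h]
  have h' : ∀ u : Fin n, ∑ v, (if u = v then (0 : ℝ) else 1) = n - 1 := fun u => by
    have : ∀ v, (if u = v then (0 : ℝ) else 1) = 1 - if u = v then 1 else 0 := fun v => by
      split_ifs <;> simp
    simp_rw [this, Finset.sum_sub_distrib]
    simp
  simp_rw [h']
  simp [mul_sub]

/-- A shortest path with `h` edges and weight `d` contributes `μ ^ h * exp (-lam * n * d)` to a sum
over all paths whose expectation is of order `1 / n`. By the concavity of the logarithm, this bounds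
the expectation of `h * log μ - lam * n * d`. -/
theorem integral_hopCountRandomPair_mul_log_le (hn : 2 ≤ n) {μ lam : ℝ} (hμ : 0 < μ)
    (hlam : μ < lam) :
    (∫ x, hopCountRandomPair x ∂(graphEdgeLaw n)) * Real.log μ ≤
      lam * (n / (n - 1)) * (1 + Real.log n) - Real.log (1 - μ / lam) - Real.log (n - 1) := by
  have hlam0 : 0 < lam := hμ.trans hlam
  have hn1 : (0 : ℝ) < n - 1 := by
    have : (2 : ℝ) ≤ n := by exact_mod_cast hn
    linarith
  have hn0 : (0 : ℝ) < n := by linarith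
  have hr : 0 < 1 - μ / lam := by
    rw [sub_pos, div_lt_one hlam0]
    exact hlam
  have hθ : 0 < lam * n := by positivity
  set b := Real.log ((n - 1) * (1 - μ / lam)) with hb
  have hexpb : Real.exp b = (n - 1) * (1 - μ / lam) := Real.exp_log (by positivity)
  -- The inequality `1 + x ≤ exp x` replaces Jensen's inequality.
  have hpt : ∀ (w : Edge n → ℝ) (e : Edge n),
      1 + b + (hopCount w e.fst e.snd * Real.log μ - lam * n * dist w e.fst e.snd) ≤
        Real.exp b * ∑ p : PathBetween n e.fst e.snd,
          μ ^ (edgesOf p).length * Real.exp (-(lam * n) * pathWeight w p) := by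
    intro w e
    obtain ⟨p, hp, hlen⟩ := exists_isShortest_length_eq_hopCount w e.fst e.snd
    calc 1 + b + (hopCount w e.fst e.snd * Real.log μ - lam * n * dist w e.fst e.snd)
        ≤ Real.exp (b + (hopCount w e.fst e.snd * Real.log μ +
            -(lam * n) * dist w e.fst e.snd)) := by
          refine le_trans (le_of_eq ?_) (Real.add_one_le_exp _)
          ring
      _ = Real.exp b * (μ ^ (edgesOf p).length * Real.exp (-(lam * n) * pathWeight w p)) := by
          rw [Real.exp_add, Real.exp_add, Real.exp_nat_mul, Real.exp_log hμ, hlen,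
            hp.pathWeight_eq]
      _ ≤ _ := by
          gcongr
          exact Finset.single_le_sum (f := fun p : PathBetween n e.fst e.snd =>
            μ ^ (edgesOf p).length * Real.exp (-(lam * n) * pathWeight w p))
            (fun p _ => by positivity) (Finset.mem_univ p)
  have hH : ∀ e : Edge n, Integrable (fun w : Edge n → ℝ => (hopCount w e.fst e.snd : ℝ))
    (weightLaw n) := fun e => integrable_hopCount _ _
  have hD : ∀ e : Edge n, Integrable (fun w : Edge n → ℝ => dist w e.fst e.snd) (weightLaw n) :=
    fun e => integrable_dist _ _
  have hint : ∀ e : Edge n,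
      1 + b + ((∫ w, (hopCount w e.fst e.snd : ℝ) ∂(weightLaw n)) * Real.log μ -
        lam * n * ∫ w, dist w e.fst e.snd ∂(weightLaw n)) ≤
        Real.exp b * ∑ p : PathBetween n e.fst e.snd, (μ / lam / n) ^ (edgesOf p).length := by
    intro e
    have hP : ∀ p : PathBetween n e.fst e.snd, Integrable (fun w =>
        μ ^ (edgesOf p).length * Real.exp (-(lam * n) * pathWeight w p)) (weightLaw n) := fun p =>
      (integrable_exp_pathWeight hθ p).const_mul _
    have hX := ((hH e).mul_const (Real.log μ)).sub ((hD e).const_mul (lam * n))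
    have h := integral_mono ((integrable_const (1 + b)).add hX)
      ((integrable_finsetSum _ fun p _ => hP p).const_mul (Real.exp b)) fun w => hpt w e
    rw [integral_add' (integrable_const _) hX, integral_sub' ((hH e).mul_const _)
      ((hD e).const_mul _), integral_const, integral_mul_const, integral_const_mul,
      integral_const_mul, integral_finsetSum _ fun p _ => hP p] at h
    simp only [probReal_univ, one_smul] at h
    refine h.trans ?_
    gcongr with p _
    rw [integral_const_mul]
    calc μ ^ (edgesOf p).length * ∫ w, Real.exp (-(lam * n) * pathWeight w p) ∂(weightLaw n)
        ≤ μ ^ (edgesOf p).length * (lam * n)⁻¹ ^ (edgesOf p).length := by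
          gcongr
          exact integral_exp_pathWeight_le hθ p
      _ = _ := by
          rw [← mul_pow, div_div, div_eq_mul_inv]
  have hsum := Finset.sum_le_sum fun e (_ : e ∈ (Finset.univ : Finset (Edge n))) => hint e
  rw [Finset.sum_add_distrib, Finset.sum_sub_distrib, ← Finset.sum_mul, ← Finset.mul_sum,
    ← Finset.mul_sum, Finset.sum_const, Finset.card_univ, nsmul_eq_mul, card_edge] at hsum
  have hpaths := sum_pow_length_le (n := n) (div_pos hμ hlam0).le (sub_pos.1 hr)
  have hR : Real.exp b * ∑ e : Edge n, ∑ p : PathBetween n e.fst e.snd,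
      (μ / lam / n) ^ (edgesOf p).length ≤ n * (n - 1) := by
    refine (mul_le_mul_of_nonneg_left hpaths (Real.exp_pos b).le).trans_eq ?_
    rw [hexpb, mul_assoc, mul_left_comm _ (n : ℝ), mul_inv_cancel₀ hr.ne', mul_one, mul_comm]
  have hdist : lam * n * ∑ e : Edge n, ∫ w, dist w e.fst e.snd ∂(weightLaw n) ≤
      lam * n * (n * (1 + Real.log n)) :=
    mul_le_mul_of_nonneg_left sum_edge_integral_dist_le hθ.le
  rw [integral_graphEdgeLaw hn (integrable_hopCountRandomPair hn), card_edge]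
  simp only [hopCountRandomPair]
  rw [integral_finsetSum _ fun e _ => hH e]
  set A := ∑ e : Edge n, ∫ w, (hopCount w e.fst e.snd : ℝ) ∂(weightLaw n)
  have hb' : b = Real.log (1 - μ / lam) + Real.log (n - 1) := by
    rw [hb, Real.log_mul hn1.ne' hr.ne', add_comm]
  have hmain : A * Real.log μ ≤
      n * (n - 1) * (lam * (n / (n - 1)) * (1 + Real.log n) - b) := by
    have : n * (n - 1) * (lam * (n / (n - 1)) * (1 + Real.log n) - b) =
        lam * n * (n * (1 + Real.log n)) - n * (n - 1) * b := by
      field_simp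
    rw [this]
    linarith
  calc (n * (n - 1) : ℝ)⁻¹ * A * Real.log μ = (n * (n - 1) : ℝ)⁻¹ * (A * Real.log μ) := by ring
    _ ≤ (n * (n - 1) : ℝ)⁻¹ *
          (n * (n - 1) * (lam * (n / (n - 1)) * (1 + Real.log n) - b)) := by
        gcongr
    _ = lam * (n / (n - 1)) * (1 + Real.log n) - b := by
        rw [inv_mul_cancel_left₀ (by positivity)]
    _ = _ := by
        rw [hb']
        ring

/-! ### Asymptotics -/

theorem tendsto_bound_div_log (lam C : ℝ) :
    Tendsto (fun n : ℕ => (lam * (n / (n - 1)) * (1 + Real.log n) - C - Real.log (n - 1)) /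
      Real.log n) atTop (𝓝 (lam - 1)) := by
  have hlog : Tendsto (fun n : ℕ => (Real.log n)⁻¹) atTop (𝓝 0) :=
    (Real.tendsto_log_atTop.comp tendsto_natCast_atTop_atTop).inv_tendsto_atTop
  have hinv : Tendsto (fun n : ℕ => ((n : ℝ))⁻¹) atTop (𝓝 0) :=
    tendsto_natCast_atTop_atTop.inv_tendsto_atTop
  have hq : Tendsto (fun n : ℕ => 1 - (n : ℝ)⁻¹) atTop (𝓝 1) := by
    simpa using hinv.const_sub 1
  have hL : Tendsto (fun n : ℕ => lam * (1 - (n : ℝ)⁻¹)⁻¹ * ((Real.log n)⁻¹ + 1) -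
      C * (Real.log n)⁻¹ - (1 + Real.log (1 - (n : ℝ)⁻¹) * (Real.log n)⁻¹)) atTop
      (𝓝 (lam * 1⁻¹ * (0 + 1) - C * 0 - (1 + Real.log 1 * 0))) :=
    ((((hq.inv₀ one_ne_zero).const_mul lam).mul (hlog.add_const 1)).sub (hlog.const_mul C)).sub
      (((hq.log one_ne_zero).mul hlog).const_add 1)
  have hval : lam * 1⁻¹ * (0 + 1) - C * 0 - (1 + Real.log 1 * 0) = lam - 1 := by simp
  rw [hval] at hL
  refine hL.congr' ?_
  filter_upwards [eventually_ge_atTop 2] with n hn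
  have hn2 : (2 : ℝ) ≤ n := by exact_mod_cast hn
  have hl : 0 < Real.log n := Real.log_pos (by linarith)
  have h1 : (n : ℝ) - 1 = n * (1 - (n : ℝ)⁻¹) := by field_simp
  have h2 : (0 : ℝ) < 1 - (n : ℝ)⁻¹ := by
    rw [sub_pos]
    exact inv_lt_one_of_one_lt₀ (by linarith)
  have h3 : (n : ℝ) / (n - 1) = (1 - (n : ℝ)⁻¹)⁻¹ := by
    rw [h1]
    field_simp
  rw [h3, h1, Real.log_mul (by positivity) h2.ne']
  field_simp

/-- If `a n * log μ` is at most `(lam - 1 + o(1)) * log n` whenever `0 < μ < lam`, then `a n` is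
asymptotic to `log n`: values of `μ` slightly above `1` bound `a n` from above, and values slightly
below `1` bound it from below. -/
theorem tendsto_div_log_of_forall_mul_log_le {a : ℕ → ℝ}
    (h : ∀ n : ℕ, 2 ≤ n → ∀ μ lam : ℝ, 0 < μ → μ < lam → a n * Real.log μ ≤
      lam * (n / (n - 1)) * (1 + Real.log n) - Real.log (1 - μ / lam) - Real.log (n - 1)) :
    Tendsto (fun n => a n / Real.log n) atTop (𝓝 1) := by
  -- For `lam = μ + (μ - 1) ^ 2`, the limiting bound is `lam - 1 = μ * (μ - 1)`.
  have key : ∀ μ c : ℝ, 0 < μ → μ ≠ 1 → μ * (μ - 1) < c * Real.log μ →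
      ∀ᶠ n : ℕ in atTop, a n / Real.log n * Real.log μ < c * Real.log μ := by
    intro μ c hμ hμ1 hc
    have hsq : 0 < (μ - 1) ^ 2 := by
      have : μ - 1 ≠ 0 := sub_ne_zero.2 hμ1
      positivity
    have hlim := tendsto_bound_div_log (μ + (μ - 1) ^ 2)
      (Real.log (1 - μ / (μ + (μ - 1) ^ 2)))
    have hlt : μ + (μ - 1) ^ 2 - 1 < c * Real.log μ := by linarith
    filter_upwards [hlim.eventually_lt_const hlt, eventually_ge_atTop 2] with n hn hn2
    refine lt_of_le_of_lt ?_ hn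
    have hl : 0 < Real.log n := Real.log_pos (by exact_mod_cast hn2)
    rw [div_mul_eq_mul_div]
    exact div_le_div_of_nonneg_right (h n hn2 μ _ hμ (by linarith)) hl.le
  refine tendsto_order.2 ⟨fun c hc => ?_, fun c hc => ?_⟩
  · -- The mean of `1` and `c` satisfies `c < μ ^ 2`.
    wlog hc0 : 0 ≤ c generalizing c
    · filter_upwards [this 0 one_pos le_rfl] with n hn
      linarith
    set μ := (1 + c) / 2 with hμ
    have hμ0 : 0 < μ := by linarith
    have hμ1 : μ < 1 := by linarith
    have hsq : c < μ ^ 2 := by nlinarith [mul_pos (sub_pos.2 hc) (sub_pos.2 hc)]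
    have hlog := Real.one_sub_inv_le_log_of_pos hμ0
    have hlog0 := Real.log_neg hμ0 hμ1
    have hdiv : μ * (μ - 1) < c * (1 - μ⁻¹) := by
      have : c * (1 - μ⁻¹) = c / μ * (μ - 1) := by field_simp
      rw [this]
      exact mul_lt_mul_of_neg_right (by rw [div_lt_iff₀ hμ0]; linarith) (by linarith)
    filter_upwards [key μ c hμ0 hμ1.ne (hdiv.trans_le (mul_le_mul_of_nonneg_left hlog hc0))]
      with n hn
    exact lt_of_mul_lt_mul_of_nonpos_right hn hlog0.le
  · -- The harmonic mean of `1` and `c` satisfies `μ ^ 2 < c`.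
    set μ := 2 * c / (1 + c) with hμ
    have hc0 : 0 < c := by linarith
    have hμ1 : 1 < μ := by
      rw [hμ, lt_div_iff₀ (by linarith)]
      linarith
    have hμ0 : 0 < μ := by linarith
    have hsq : μ ^ 2 < c := by
      rw [hμ, div_pow, div_lt_iff₀ (by positivity)]
      nlinarith [mul_pos hc0 (mul_pos (sub_pos.2 hc) (sub_pos.2 hc))]
    have hlog := Real.one_sub_inv_le_log_of_pos hμ0
    have hdiv : μ * (μ - 1) < c * (1 - μ⁻¹) := by
      have : c * (1 - μ⁻¹) = c / μ * (μ - 1) := by field_simp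
      rw [this]
      exact mul_lt_mul_of_pos_right (by rw [lt_div_iff₀ hμ0]; linarith) (by linarith)
    filter_upwards [key μ c hμ0 hμ1.ne' (hdiv.trans_le (mul_le_mul_of_nonneg_left hlog hc0.le))]
      with n hn
    exact lt_of_mul_lt_mul_of_nonneg_right hn (Real.log_pos hμ1).le

theorem tendsto_integral_hopCountRandomPair_div_log :
    Tendsto (fun n : ℕ => (∫ x, hopCountRandomPair x ∂(graphEdgeLaw n)) / Real.log n) atTop
      (𝓝 1) :=
  tendsto_div_log_of_forall_mul_log_le fun _ hn _ _ hμ hlam =>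
    integral_hopCountRandomPair_mul_log_le hn hμ hlam

end RandomAPSP

open RandomAPSP in
theorem mainTheorem7 :
    (∀ n : ℕ, 2 ≤ n →
      Integrable (numDestroyed (n := n)) (updateLaw n) ∧
      Integrable (numCreated (n := n)) (updateLaw n) ∧
      ∫ ω, numDestroyed ω ∂(updateLaw n) = ∫ ω, numCreated ω ∂(updateLaw n)) ∧
    (∃ ε : ℕ → ℝ, Tendsto ε atTop (𝓝 0) ∧ ∀ n : ℕ, 2 ≤ n →
      ∫ ω, numDestroyed ω ∂(updateLaw n) ≤ (2 + ε n) * Real.log n ∧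
      ∫ ω, numCreated ω ∂(updateLaw n) ≤ (2 + ε n) * Real.log n) ∧
    (∀ n : ℕ, 2 ≤ n →
      Integrable (numThrough (n := n)) (graphEdgeLaw n) ∧
      Integrable (hopCountRandomPair (n := n)) (graphEdgeLaw n) ∧
      ∫ x, numThrough x ∂(graphEdgeLaw n) = ∫ x, hopCountRandomPair x ∂(graphEdgeLaw n)) ∧
    (∃ ε : ℕ → ℝ, Tendsto ε atTop (𝓝 0) ∧ ∀ n : ℕ, 2 ≤ n →
      ∫ x, hopCountRandomPair x ∂(graphEdgeLaw n) = (1 + ε n) * Real.log n) := by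
  let ε : ℕ → ℝ := fun n => (∫ x, hopCountRandomPair x ∂(graphEdgeLaw n)) / Real.log n - 1
  have hε : Tendsto ε atTop (𝓝 0) := by
    simpa using tendsto_integral_hopCountRandomPair_div_log.sub_const 1
  have heq : ∀ n : ℕ, 2 ≤ n →
      ∫ x, hopCountRandomPair x ∂(graphEdgeLaw n) = (1 + ε n) * Real.log n := fun n hn => by
    have hl : 0 < Real.log n := Real.log_pos (by exact_mod_cast hn)
    simp only [ε]
    field_simp
    ring
  have hdes : ∀ n : ℕ, 2 ≤ n →
      ∫ ω, numDestroyed ω ∂(updateLaw n) ≤ (2 + 2 * ε n) * Real.log n := fun n hn => by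
    refine (integral_numDestroyed_le hn).trans_eq ?_
    rw [integral_numThrough_eq_integral_hopCountRandomPair hn, heq n hn]
    ring
  refine ⟨fun n hn => ⟨integrable_numDestroyed hn, integrable_numCreated hn,
    integral_numDestroyed_eq_integral_numCreated hn⟩, ⟨fun n => 2 * ε n, ?_, fun n hn =>
    ⟨hdes n hn, (integral_numDestroyed_eq_integral_numCreated hn).symm.trans_le (hdes n hn)⟩⟩,
    fun n hn => ⟨integrable_numThrough hn, integrable_hopCountRandomPair hn,
    integral_numThrough_eq_integral_hopCountRandomPair hn⟩, ⟨ε, hε, heq⟩⟩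
  simpa using hε.const_mul 2
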